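/- For $n\ge 2$ let $N_n$ be the group of real upper triangular $n\times n$ matrices with unit diagonal, and let $N_n^+\subset N_n$ be the set of those $M\in N_n$ all of whose minors that do not vanish identically on $N_n$ are positive. Let $P$ be the $n\times n$ matrix with $P_{ij}=\delta_{i+j,n+1}$. For every $M\in N_n^+$ there are unique $M',M''\in N_n^+$ and a unique diagonal matrix $D_M$ such that $$PMP=M'\,P\,D_M\,M''.$$ For $I,J\subset\{1,\dots,n\}$ let $\Delta_I(M)$ be the minor of $M$ with rows $I$ and the last $|I|$ columns, and $\Delta^J(M)$ the minor with the first $|J|$ rows and columns $J$; $\Delta_\emptyset=\Delta^\emptyset=1$. Write $[a,b]=\{i\in\mathbb{N}: a\le i\le b\}$. For $1\le a<b<c\le n$ put (all minors taken of $M$) $$Y_{abc}=\frac{\Delta_{[a,b-1]\cup[c+1,n]}\,\Delta_{[a+1,b]\cup[c,n]}}{\Delta_{[a,b]\cup[c+1,n]}\,\Delta_{[a+1,b-1]\cup[c,n]}},\qquad \tilde Y_{abc}=\frac{\Delta_{[1,a]\cup[b+1,c-1]}\,\Delta_{[1,a-1]\cup[b,c]}}{\Delta_{[1,a]\cup[b,c-1]}\,\Delta_{[1,a-1]\cup[b+1,c]}},$$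 $$Y^{abc}=\frac{\Delta^{[a,b]\cup[c+1,n]}\,\Delta^{[a+1,b-1]\cup[c,n]}}{\Delta^{[a,b-1]\cup[c+1,n]}\,\Delta^{[a+1,b]\cup[c,n]}},\qquad \tilde Y^{abc}=\frac{\Delta^{[1,a]\cup[b,c-1]}\,\Delta^{[1,a-1]\cup[b+1,c]}}{\Delta^{[1,a]\cup[b+1,c-1]}\,\Delta^{[1,a-1]\cup[b,c]}}.$$ Let $l(x)=\frac{6}{\pi^2}L\bigl(\frac{x}{1+x}\bigr)$ for $x>0$, where $L(x)=\mathrm{Li}_2(x)+\frac12\log x\,\log(1-x)$ and $\mathrm{Li}_2(x)=\sum_{k\ge1}x^k/k^2$ for $0<x<1$, and let $T_n=\{(a,b,c)\in\mathbb{N}^3: 1\le a<b<c\le n\}$. Theorem. For every $M\in N_n^+$, $$\begin{aligned} &\sum_{T_n} l\bigl(Y_{abc}(M')\bigr)=\sum_{T_n} l\Bigl(\frac1{Y_{abc}(M)}\Bigr)=\sum_{T_n} l\bigl(Y_{abc}(M'')\bigr)\\ =&\sum_{T_n} l\bigl(\tilde Y^{abc}(M')\bigr)=\sum_{T_n} l\Bigl(\frac1{\tilde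 Y^{abc}(M)}\Bigr)=\sum_{T_n} l\bigl(\tilde Y^{abc}(M'')\bigr)\\ =&\sum_{T_n} l\bigl(\tilde Y_{abc}(M')\bigr)=\sum_{T_n} l\Bigl(\frac1{\tilde Y_{abc}(M)}\Bigr)=\sum_{T_n} l\bigl(\tilde Y_{abc}(M'')\bigr)\\ =&\sum_{T_n} l\bigl(Y^{abc}(M')\bigr)=\sum_{T_n} l\Bigl(\frac1{Y^{abc}(M)}\Bigr)=\sum_{T_n} l\bigl(Y^{abc}(M'')\bigr), \end{aligned}$$ where each sum runs over all $(a,b,c)\in T_n$. -/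

import Mathlib

/-- The dilogarithm `Li₂(x) = ∑_{k ≥ 1} x ^ k / k ^ 2`; the series converges for `|x| ≤ 1`. -/
noncomputable def dilog (x : ℝ) : ℝ := ∑' k : ℕ, x ^ (k + 1) / ((k : ℝ) + 1) ^ 2

/-- The Rogers dilogarithm, meaningful for `0 < x < 1`. -/
noncomputable def rogersL (x : ℝ) : ℝ := dilog x + 1 / 2 * Real.log x * Real.log (1 - x)

/-- The rescaled Rogers dilogarithm `l`, meaningful for `0 < x`. -/
noncomputable def rogersl (x : ℝ) : ℝ := 6 / Real.pi ^ 2 * rogersL (x / (1 + x))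

/-- Membership in `N_n`: upper triangular with unit diagonal. -/
def IsUpperUnitriangular {n : ℕ} (M : Matrix (Fin n) (Fin n) ℝ) : Prop :=
  (∀ i j, j < i → M i j = 0) ∧ ∀ i, M i i = 1

/-- Membership in `N_n⁺`: every minor that does not vanish identically on `N_n` is positive.
A minor is given by increasing lists `I` of rows and `J` of columns of the same length. -/
def IsTotallyPositiveUnitriangular {n : ℕ} (M : Matrix (Fin n) (Fin n) ℝ) : Prop :=
  IsUpperUnitriangular M ∧
    ∀ (k : ℕ) (I J : Fin k ↪o Fin n),
      (∃ H : Matrix (Fin n) (Fin n) ℝ, IsUpperUnitriangular H ∧ (H.submatrix I J).det ≠ 0) →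
        0 < (M.submatrix I J).det

/-- The permutation matrix of `w₀`: ones on the antidiagonal. -/
def antidiagonalMatrix (n : ℕ) : Matrix (Fin n) (Fin n) ℝ :=
  Matrix.of fun i j => if (i : ℕ) + (j : ℕ) + 1 = n then 1 else 0

/-- `M' = A`, `M'' = B` and `D_M = diagonal d`: both `A` and `B` lie in `N_n⁺` and
`P M P = A P D B`. -/
def IsGaussTriple {n : ℕ} (M A B : Matrix (Fin n) (Fin n) ℝ) (d : Fin n → ℝ) : Prop :=
  IsTotallyPositiveUnitriangular A ∧ IsTotallyPositiveUnitriangular B ∧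
    antidiagonalMatrix n * M * antidiagonalMatrix n =
      A * antidiagonalMatrix n * Matrix.diagonal d * B

/-- The subset of `Fin n` that a set `I ⊆ {1, …, n}` of one-based labels stands for. -/
def labelSet (n : ℕ) (I : Finset ℕ) : Finset (Fin n) :=
  Finset.univ.filter fun i => (i : ℕ) + 1 ∈ I

theorem labelSet_card_le (n : ℕ) (I : Finset ℕ) : (labelSet n I).card ≤ n := by
  simpa using Finset.card_le_univ (labelSet n I)

/-- The right flag minor `Δ_I`: rows labelled by `I ⊆ {1, …, n}`, last `|I|` columns. -/
def rightFlagMinor {n : ℕ} (M : Matrix (Fin n) (Fin n) ℝ) (I : Finset ℕ) : ℝ :=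
  (M.submatrix ((labelSet n I).orderEmbOfFin rfl)
    (fun k : Fin (labelSet n I).card =>
      (⟨n - (labelSet n I).card + k, by
        have h1 := labelSet_card_le n I
        have h2 := k.isLt
        omega⟩ : Fin n))).det

/-- The upper flag minor `Δ^J`: first `|J|` rows, columns labelled by `J ⊆ {1, …, n}`. -/
def upperFlagMinor {n : ℕ} (M : Matrix (Fin n) (Fin n) ℝ) (J : Finset ℕ) : ℝ :=
  (M.submatrix (Fin.castLE (labelSet_card_le n J)) ((labelSet n J).orderEmbOfFin rfl)).det

/-- `Y_{abc}`. -/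
noncomputable def lowerY {n : ℕ} (M : Matrix (Fin n) (Fin n) ℝ) (a b c : ℕ) : ℝ :=
  (rightFlagMinor M (Finset.Icc a (b - 1) ∪ Finset.Icc (c + 1) n) *
      rightFlagMinor M (Finset.Icc (a + 1) b ∪ Finset.Icc c n)) /
    (rightFlagMinor M (Finset.Icc a b ∪ Finset.Icc (c + 1) n) *
      rightFlagMinor M (Finset.Icc (a + 1) (b - 1) ∪ Finset.Icc c n))

/-- `Ỹ_{abc}`. -/
noncomputable def lowerYTilde {n : ℕ} (M : Matrix (Fin n) (Fin n) ℝ) (a b c : ℕ) : ℝ :=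
  (rightFlagMinor M (Finset.Icc 1 a ∪ Finset.Icc (b + 1) (c - 1)) *
      rightFlagMinor M (Finset.Icc 1 (a - 1) ∪ Finset.Icc b c)) /
    (rightFlagMinor M (Finset.Icc 1 a ∪ Finset.Icc b (c - 1)) *
      rightFlagMinor M (Finset.Icc 1 (a - 1) ∪ Finset.Icc (b + 1) c))

/-- `Y^{abc}`. -/
noncomputable def upperY {n : ℕ} (M : Matrix (Fin n) (Fin n) ℝ) (a b c : ℕ) : ℝ :=
  (upperFlagMinor M (Finset.Icc a b ∪ Finset.Icc (c + 1) n) *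
      upperFlagMinor M (Finset.Icc (a + 1) (b - 1) ∪ Finset.Icc c n)) /
    (upperFlagMinor M (Finset.Icc a (b - 1) ∪ Finset.Icc (c + 1) n) *
      upperFlagMinor M (Finset.Icc (a + 1) b ∪ Finset.Icc c n))

/-- `Ỹ^{abc}`. -/
noncomputable def upperYTilde {n : ℕ} (M : Matrix (Fin n) (Fin n) ℝ) (a b c : ℕ) : ℝ :=
  (upperFlagMinor M (Finset.Icc 1 a ∪ Finset.Icc b (c - 1)) *
      upperFlagMinor M (Finset.Icc 1 (a - 1) ∪ Finset.Icc (b + 1) c)) /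
    (upperFlagMinor M (Finset.Icc 1 a ∪ Finset.Icc (b + 1) (c - 1)) *
      upperFlagMinor M (Finset.Icc 1 (a - 1) ∪ Finset.Icc b c))

/-- The discrete tetrahedron `T_n`: triples `1 ≤ a < b < c ≤ n`. -/
def tetrahedron (n : ℕ) : Finset (ℕ × ℕ × ℕ) :=
  (Finset.Icc 1 n ×ˢ Finset.Icc 1 n ×ˢ Finset.Icc 1 n).filter
    fun t => t.1 < t.2.1 ∧ t.2.1 < t.2.2

/-- `∑_{(a,b,c) ∈ T_n} l(Y a b c)`. -/
noncomputable def dilogSum (n : ℕ) (Y : ℕ → ℕ → ℕ → ℝ) : ℝ :=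
  ∑ t ∈ tetrahedron n, rogersl (Y t.1 t.2.1 t.2.2)

/-! Up to inversion, each `Y` is an `exchangeRatio` of a function `f` on subsets of {1, …, n}, with
`f` given by flag minors. The three-term Plücker relation turns `l` of such a ratio into a multiple
of the Rogers dilogarithm of a quotient of products of minors. For four labels p < q < r < s, the
five-term relation is used twice: once on singletons and pairs, once on triples and pairs. Both uses
produce the same extra term, so subtracting them gives an identity with four dilogarithms on each
side (`IsPositiveFlag.four_term`).

`Y_{abc}` and `Ỹ_{abc}` belong to the two extreme contexts (a,b) ∪ (c,n] and [1,a) ∪ (b,c). Passing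
from one to the other label by label changes the total by one four-term identity per quadruple, so
the two sums agree (`IsPositiveFlag.sum_exchangeRatio_eq`).

The Gauss decomposition enters through `rightFlagMinor_mul_of_gauss`: a right flag minor of `M'` is
the minor of `M` on the reflected rows, divided by a factor depending only on the size. These
factors cancel in exchange ratios, and reflection inverts the ratios, so `Y(M')` becomes `1/Ỹ(M)`
and `Ỹ(M')` becomes `1/Y(M)`. Reflection in the antidiagonal interchanges right and upper flag
minors and the roles of `M'` and `M''`. Finally, the minors in `Y_{abc}` have consecutive rows and
columns up to a unitriangular corner, so they are upper flag minors as well; this identifies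
`Y_{abc}` with `Ỹ^{a,a+c-b,c}` and ties the two families together.

The factorization exists because the trailing principal minors of `P M` do not vanish. It is unique
because flag minors determine a unitriangular matrix. Its factors are totally positive because
positive right flag minors suffice, by a Plücker induction
(`IsUpperUnitriangular.det_submatrix_pos`). -/

open Filter Topology Matrix

/-! ### The Rogers dilogarithm and its five-term relation. -/

/-- The derivative of the dilogarithm on `(0, 1)`. -/
theorem hasDerivAt_dilog {x : ℝ} (h0 : 0 < x) (h1 : x < 1) :
    HasDerivAt dilog (-Real.log (1 - x) / x) x := by
  obtain ⟨r, hxr, hr1⟩ := exists_between h1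
  have hr0 : 0 < r := h0.trans hxr
  -- The termwise derivative is the series of -log(1 - x) divided by x.
  have hsum : HasSum (fun k : ℕ => x ^ k / ((k : ℝ) + 1)) (-Real.log (1 - x) / x) := by
    have h := (Real.hasSum_pow_div_log_of_abs_lt_one (abs_lt.2 ⟨by linarith, h1⟩)).div_const x
    refine h.congr_fun ?_
    intro k
    field_simp
    ring
  have key : HasDerivAt (fun z : ℝ => ∑' k : ℕ, z ^ (k + 1) / ((k : ℝ) + 1) ^ 2)
      (∑' k : ℕ, x ^ k / ((k : ℝ) + 1)) x := by
    -- On the ball of radius r, with x < r < 1, the derivatives are dominated by the geometric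
    -- series of ratio r.
    refine hasDerivAt_tsum_of_isPreconnected (u := fun k : ℕ => r ^ k)
      (g := fun k z => z ^ (k + 1) / ((k : ℝ) + 1) ^ 2) (g' := fun k z => z ^ k / ((k : ℝ) + 1))
      (t := Metric.ball (0 : ℝ) r) (y₀ := 0)
      (summable_geometric_of_lt_one hr0.le hr1) Metric.isOpen_ball
      (convex_ball _ _).isPreconnected ?_ ?_ (by simpa using hr0) ?_ ?_
    · intro k z _
      have hk : (k : ℝ) + 1 ≠ 0 := by positivity
      refine ((hasDerivAt_pow (k + 1) z).div_const (((k : ℝ) + 1) ^ 2)).congr_deriv ?_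
      rw [Nat.cast_succ, Nat.add_sub_cancel, div_eq_div_iff (pow_ne_zero 2 hk) hk]
      ring
    · intro k z hz
      rw [Metric.mem_ball, dist_zero_right] at hz
      rw [norm_div, norm_pow]
      have hk : (1 : ℝ) ≤ ‖(k : ℝ) + 1‖ := by
        rw [Real.norm_of_nonneg (by positivity)]
        have := k.cast_nonneg (α := ℝ)
        linarith
      exact (div_le_self (by positivity) hk).trans (pow_le_pow_left₀ (norm_nonneg _) hz.le k)
    · simp
    · rw [Metric.mem_ball, dist_zero_right, Real.norm_of_nonneg h0.le]
      exact hxr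
  rw [hsum.tsum_eq] at key
  exact key

theorem tendsto_dilog_zero : Tendsto dilog (𝓝[>] 0) (𝓝 0) := by
  have hs : Summable fun k : ℕ => 1 / ((k : ℝ) + 1) ^ 2 := by
    have := (summable_nat_add_iff 1).2 (Real.summable_one_div_nat_pow.2 one_lt_two)
    simpa using this
  have hle : ∀ x ∈ Set.Ioo (0 : ℝ) 1, dilog x ≤ x * ∑' k : ℕ, 1 / ((k : ℝ) + 1) ^ 2 := by
    intro x hx
    have hb : ∀ k : ℕ, x ^ (k + 1) / ((k : ℝ) + 1) ^ 2 ≤ x * (1 / ((k : ℝ) + 1) ^ 2) := by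
      intro k
      rw [mul_one_div]
      gcongr
      rw [pow_succ]
      exact mul_le_of_le_one_left hx.1.le (pow_le_one₀ hx.1.le hx.2.le)
    rw [← tsum_mul_left]
    have hpos : ∀ k : ℕ, 0 ≤ x ^ (k + 1) / ((k : ℝ) + 1) ^ 2 := fun k => by
      have := hx.1
      positivity
    exact (Summable.of_nonneg_of_le hpos hb (hs.mul_left x)).tsum_le_tsum hb (hs.mul_left x)
  have hlim : Tendsto (fun x : ℝ => x * ∑' k : ℕ, 1 / ((k : ℝ) + 1) ^ 2) (𝓝[>] 0) (𝓝 0) := by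
    have : Tendsto (fun x : ℝ => x * ∑' k : ℕ, 1 / ((k : ℝ) + 1) ^ 2) (𝓝 0)
        (𝓝 (0 * ∑' k : ℕ, 1 / ((k : ℝ) + 1) ^ 2)) := tendsto_id.mul_const _
    rw [zero_mul] at this
    exact this.mono_left nhdsWithin_le_nhds
  have hmem : Set.Ioo (0 : ℝ) 1 ∈ 𝓝[>] (0 : ℝ) := Ioo_mem_nhdsGT one_pos
  refine tendsto_of_tendsto_of_tendsto_of_le_of_le' tendsto_const_nhds hlim ?_ ?_
  · filter_upwards [hmem] with x hx
    refine tsum_nonneg fun k => ?_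
    have := hx.1
    positivity
  · filter_upwards [hmem] with x hx using hle x hx

theorem hasDerivAt_rogersL {x : ℝ} (h0 : 0 < x) (h1 : x < 1) :
    HasDerivAt rogersL
      (-(1 / 2) * (Real.log (1 - x) / x + Real.log x / (1 - x))) x := by
  have h1' : (1 - x) ≠ 0 := by linarith
  have hl : HasDerivAt (fun y : ℝ => Real.log (1 - y)) (-1 / (1 - x)) x :=
    ((hasDerivAt_id x).const_sub 1).log h1'
  have h := (hasDerivAt_dilog h0 h1).add (((Real.hasDerivAt_log h0.ne').const_mul (1 / 2)).mul hl)
  refine h.congr_deriv ?_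
  field_simp
  ring

/-- The logarithmic term is (x log x) · (log(1 - x) / x), with factors tending to 0 and -1. -/
theorem tendsto_rogersL_zero : Tendsto rogersL (𝓝[>] 0) (𝓝 0) := by
  have hlog : Tendsto (fun x : ℝ => Real.log x * Real.log (1 - x)) (𝓝[>] 0) (𝓝 0) := by
    have h2 : Tendsto (fun x : ℝ => Real.log x * x) (𝓝[>] 0) (𝓝 0) := by
      simpa using tendsto_log_mul_rpow_nhdsGT_zero one_pos
    have hd : HasDerivAt (fun y : ℝ => Real.log (1 - y)) (-1 / (1 - 0)) 0 :=
      ((hasDerivAt_id (0 : ℝ)).const_sub 1).log (by norm_num)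
    have h3 : Tendsto (fun x : ℝ => x⁻¹ * Real.log (1 - x)) (𝓝[>] 0) (𝓝 (-1)) := by
      have := hd.tendsto_slope_zero_right
      simpa using this
    have h4 := h2.mul h3
    rw [zero_mul] at h4
    refine h4.congr' ?_
    filter_upwards [self_mem_nhdsWithin] with x hx
    have : x ≠ 0 := ne_of_gt hx
    field_simp
  have := tendsto_dilog_zero.add (hlog.const_mul (1 / 2))
  simp only [mul_zero, add_zero] at this
  refine this.congr fun x => ?_
  rw [rogersL, mul_assoc]

/-- The five-term relation of the Rogers dilogarithm. -/
theorem rogersL_five_term {x y : ℝ} (hx0 : 0 < x) (hx1 : x < 1) (hy0 : 0 < y) (hy1 : y < 1) :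
    rogersL x + rogersL y = rogersL (x * y) + rogersL (x * (1 - y) / (1 - x * y)) +
      rogersL (y * (1 - x) / (1 - x * y)) := by
  -- With y fixed, the defect of the relation has zero derivative in the first argument and tends to
  -- 0 as that argument does.
  let g : ℝ → ℝ := fun t => rogersL t + rogersL y - (rogersL (t * y) +
    rogersL (t * (1 - y) / (1 - t * y)) + rogersL (y * (1 - t) / (1 - t * y)))
  have hy1' : 0 < 1 - y := by linarith
  have hty : ∀ t ∈ Set.Ioo (0 : ℝ) 1, 0 < 1 - t * y := fun t ht => by nlinarith [ht.1, ht.2]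
  have hderiv : ∀ t ∈ Set.Ioo (0 : ℝ) 1, HasDerivAt g 0 t := by
    intro t ht
    have ht0 := ht.1
    have ht1 : 0 < 1 - t := by linarith [ht.2]
    have hC := hty t ht
    have e2 : 1 - t * (1 - y) / (1 - t * y) = (1 - t) / (1 - t * y) := by field_simp; ring
    have e3 : 1 - y * (1 - t) / (1 - t * y) = (1 - y) / (1 - t * y) := by
      rw [eq_div_iff hC.ne', sub_mul, div_mul_cancel₀ _ hC.ne']
      ring
    have d1 : HasDerivAt (fun t => t * y) y t := by simpa using (hasDerivAt_id t).mul_const y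
    have dC : HasDerivAt (fun t => 1 - t * y) (-y) t := d1.const_sub 1
    have d2 : HasDerivAt (fun t => t * (1 - y) / (1 - t * y)) ((1 - y) / (1 - t * y) ^ 2) t := by
      refine (((hasDerivAt_id t).mul_const (1 - y)).div dC hC.ne').congr_deriv ?_
      simp only [id]
      field_simp
      ring
    have d3 : HasDerivAt (fun t => y * (1 - t) / (1 - t * y))
        (-(y * (1 - y)) / (1 - t * y) ^ 2) t := by
      refine ((((hasDerivAt_id t).const_sub 1).const_mul y).div dC hC.ne').congr_deriv ?_
      simp only [id]
      field_simp
      ring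
    have r0 := hasDerivAt_rogersL ht.1 ht.2
    have r1 := (hasDerivAt_rogersL (mul_pos ht0 hy0) (by linarith)).comp t d1
    have r2 := (hasDerivAt_rogersL (x := t * (1 - y) / (1 - t * y)) (by positivity) (by
      have : 0 < 1 - t * (1 - y) / (1 - t * y) := by rw [e2]; positivity
      linarith)).comp t d2
    have r3 := (hasDerivAt_rogersL (x := y * (1 - t) / (1 - t * y)) (by positivity) (by
      have : 0 < 1 - y * (1 - t) / (1 - t * y) := by rw [e3]; positivity
      linarith)).comp t d3
    have h := (r0.add_const (rogersL y)).sub ((r1.add r2).add r3)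
    refine h.congr_deriv ?_
    rw [e2, e3, Real.log_div ht1.ne' hC.ne', Real.log_div hy1'.ne' hC.ne',
      Real.log_div (by positivity) hC.ne', Real.log_div (by positivity) hC.ne',
      Real.log_mul ht0.ne' hy1'.ne', Real.log_mul hy0.ne' ht1.ne', Real.log_mul ht0.ne' hy0.ne']
    -- Every logarithm has been expanded into these five; their coefficients are rational functions
    -- and cancel identically.
    generalize Real.log t = a
    generalize Real.log y = b
    generalize Real.log (1 - t) = A
    generalize Real.log (1 - y) = B
    generalize Real.log (1 - t * y) = C
    have n1 := ht1.ne'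
    have n2 := hy1'.ne'
    have n3 := hC.ne'
    field_simp
    ring
  have hconst : ∀ t ∈ Set.Ioo (0 : ℝ) 1, g t = g x := by
    intro t ht
    refine (convex_Ioo (0 : ℝ) 1).is_const_of_fderivWithin_eq_zero (𝕜 := ℝ)
      (fun s hs => (hderiv s hs).differentiableAt.differentiableWithinAt) ?_ ht ⟨hx0, hx1⟩
    intro s hs
    rw [fderivWithin_of_isOpen isOpen_Ioo hs]
    ext
    simp [(hderiv s hs).deriv]
  have hlim : Tendsto g (𝓝[>] 0) (𝓝 0) := by
    have hmem : Set.Ioo (0 : ℝ) 1 ∈ 𝓝[>] (0 : ℝ) := Ioo_mem_nhdsGT one_pos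
    have l1 : Tendsto (fun t : ℝ => t * y) (𝓝[>] 0) (𝓝[>] 0) := by
      refine tendsto_nhdsWithin_iff.2 ⟨?_, ?_⟩
      · have : ContinuousAt (fun t : ℝ => t * y) 0 := by fun_prop
        have := this.tendsto
        rw [zero_mul] at this
        exact this.mono_left nhdsWithin_le_nhds
      · filter_upwards [hmem] with t ht using mul_pos ht.1 hy0
    have l2 : Tendsto (fun t : ℝ => t * (1 - y) / (1 - t * y)) (𝓝[>] 0) (𝓝[>] 0) := by
      refine tendsto_nhdsWithin_iff.2 ⟨?_, ?_⟩
      · have : ContinuousAt (fun t : ℝ => t * (1 - y) / (1 - t * y)) 0 :=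
          ContinuousAt.div (by fun_prop) (by fun_prop) (by norm_num)
        have := this.tendsto
        simp only [zero_mul, zero_div] at this
        exact this.mono_left nhdsWithin_le_nhds
      · filter_upwards [hmem] with t ht using div_pos (mul_pos ht.1 hy1') (hty t ht)
    have l3 : Tendsto (fun t : ℝ => y * (1 - t) / (1 - t * y)) (𝓝[>] 0) (𝓝 y) := by
      have : ContinuousAt (fun t : ℝ => y * (1 - t) / (1 - t * y)) 0 :=
        ContinuousAt.div (by fun_prop) (by fun_prop) (by norm_num)
      have := this.tendsto
      simp only [zero_mul, sub_zero, mul_one, div_one] at this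
      exact this.mono_left nhdsWithin_le_nhds
    have c : Tendsto rogersL (𝓝 y) (𝓝 (rogersL y)) := (hasDerivAt_rogersL hy0 hy1).continuousAt
    have := (tendsto_rogersL_zero.add_const (rogersL y)).sub
      (((tendsto_rogersL_zero.comp l1).add (tendsto_rogersL_zero.comp l2)).add (c.comp l3))
    simpa using this
  have hg : g x = 0 := by
    refine tendsto_nhds_unique (tendsto_const_nhds.congr' ?_) hlim
    filter_upwards [Ioo_mem_nhdsGT (one_pos : (0 : ℝ) < 1)] with t ht using (hconst t ht).symm
  exact sub_eq_zero.1 hg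

/-! ### Positive flag functions and the four-term identity. -/

/-- The ratio `f(Xa) f(Xbc) / (f(Xab) f(Xc))` attached to a function `f` of finite sets. -/
noncomputable def exchangeRatio (f : Finset ℕ → ℝ) (X : Finset ℕ) (a b c : ℕ) : ℝ :=
  (f (insert a X) * f (insert b (insert c X))) / (f (insert a (insert b X)) * f (insert c X))

/-- Positivity and the three-term relations for a function of subsets of `{1, …, n}`. -/
structure IsPositiveFlag (n : ℕ) (f : Finset ℕ → ℝ) : Prop where
  pos : ∀ I ⊆ Finset.Icc 1 n, 0 < f I
  three_term : ∀ (X : Finset ℕ) (a b c : ℕ), X ⊆ Finset.Icc 1 n → a ∈ Finset.Icc 1 n →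
    c ∈ Finset.Icc 1 n → a < b → b < c → a ∉ X → b ∉ X → c ∉ X →
    f (insert b X) * f (insert a (insert c X)) =
      f (insert a (insert b X)) * f (insert c X) + f (insert a X) * f (insert b (insert c X))

/-- In the application, h is a three-term relation: q and p are its two summands, and r is their
sum, again a product of two values of the flag function. -/
theorem rogersl_div {p q r : ℝ} (hq : 0 < q) (hr : 0 < r) (h : r = q + p) :
    rogersl (p / q) = 6 / Real.pi ^ 2 * rogersL (p / r) := by
  rw [rogersl]
  congr 2
  subst h
  field_simp

/-- The five-term relation for the quotients of a positive solution of the three-term relations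
on one- and two-element subsets of a four-element set. -/
theorem rogersL_three_term_aux {f1 f2 f3 f4 f12 f13 f14 f23 f24 f34 : ℝ}
    (h1 : 0 < f1) (h2 : 0 < f2) (h3 : 0 < f3) (h4 : 0 < f4) (h12 : 0 < f12) (h13 : 0 < f13)
    (h14 : 0 < f14) (h23 : 0 < f23) (h24 : 0 < f24) (h34 : 0 < f34)
    (e124 : f2 * f14 = f12 * f4 + f1 * f24)
    (e134 : f3 * f14 = f13 * f4 + f1 * f34) (e234 : f3 * f24 = f23 * f4 + f2 * f34) :
    rogersL (f1 * f24 / (f2 * f14)) + rogersL (f2 * f34 / (f3 * f24)) =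
      rogersL (f1 * f34 / (f3 * f14)) + rogersL (f1 * f23 / (f2 * f13)) +
        rogersL (f12 * f34 / (f13 * f24)) := by
  -- These are the arguments x and y of the five-term relation. The relations for triples containing
  -- 4 factor 1 - x, 1 - y and 1 - xy, so that the other three arguments are monomial quotients too.
  have hx : f1 * f24 / (f2 * f14) < 1 := by
    rw [div_lt_one (by positivity), e124]
    have := mul_pos h12 h4
    linarith
  have hy : f2 * f34 / (f3 * f24) < 1 := by
    rw [div_lt_one (by positivity), e234]
    have := mul_pos h23 h4
    linarith
  have hx' : 1 - f1 * f24 / (f2 * f14) = f12 * f4 / (f2 * f14) := by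
    rw [eq_div_iff (by positivity), sub_mul, div_mul_cancel₀ _ (by positivity)]
    linarith
  have hy' : 1 - f2 * f34 / (f3 * f24) = f23 * f4 / (f3 * f24) := by
    rw [eq_div_iff (by positivity), sub_mul, div_mul_cancel₀ _ (by positivity)]
    linarith
  have hxy : f1 * f24 / (f2 * f14) * (f2 * f34 / (f3 * f24)) = f1 * f34 / (f3 * f14) := by
    field_simp
  have hxy' : 1 - f1 * f34 / (f3 * f14) = f13 * f4 / (f3 * f14) := by
    rw [eq_div_iff (by positivity), sub_mul, div_mul_cancel₀ _ (by positivity)]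
    linarith
  rw [rogersL_five_term (by positivity) hx (by positivity) hy, hxy, hxy', hx', hy']
  congr 2
  · congr 1
    field_simp
  · field_simp

/-- Reversing the order of the exchanges of the four triples in `{p, q, r, s}` preserves the sum of
the dilogarithms. -/
theorem IsPositiveFlag.four_term {n : ℕ} {f : Finset ℕ → ℝ} (hf : IsPositiveFlag n f)
    {Z : Finset ℕ} (hZ : Z ⊆ Finset.Icc 1 n) {p q r s : ℕ} (hp : 1 ≤ p) (hpq : p < q) (hqr : q < r)
    (hrs : r < s) (hs : s ≤ n) (hpZ : p ∉ Z) (hqZ : q ∉ Z) (hrZ : r ∉ Z) (hsZ : s ∉ Z) :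
    rogersl (exchangeRatio f (insert s Z) p q r) + rogersl (exchangeRatio f Z p q s) +
      rogersl (exchangeRatio f (insert q Z) p r s) + rogersl (exchangeRatio f Z q r s) =
    rogersl (exchangeRatio f Z p q r) + rogersl (exchangeRatio f (insert r Z) p q s) +
      rogersl (exchangeRatio f Z p r s) + rogersl (exchangeRatio f (insert p Z) q r s) := by
  have hp' : p ∈ Finset.Icc 1 n := Finset.mem_Icc.2 (by omega)
  have hq' : q ∈ Finset.Icc 1 n := Finset.mem_Icc.2 (by omega)
  have hr' : r ∈ Finset.Icc 1 n := Finset.mem_Icc.2 (by omega)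
  have hs' : s ∈ Finset.Icc 1 n := Finset.mem_Icc.2 (by omega)
  have key : ∀ (X : Finset ℕ) (a b c : ℕ), X ⊆ Finset.Icc 1 n → a ∈ Finset.Icc 1 n →
      b ∈ Finset.Icc 1 n → c ∈ Finset.Icc 1 n → a < b → b < c → a ∉ X → b ∉ X → c ∉ X →
      rogersl (exchangeRatio f X a b c) = 6 / Real.pi ^ 2 *
        rogersL (f (insert a X) * f (insert b (insert c X)) /
          (f (insert b X) * f (insert a (insert c X)))) := by
    intro X a b c hX ha hb hc hab hbc haX hbX hcX
    have hi : ∀ {x : ℕ} {S : Finset ℕ}, x ∈ Finset.Icc 1 n → S ⊆ Finset.Icc 1 n →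
      insert x S ⊆ Finset.Icc 1 n := fun h h' => Finset.insert_subset h h'
    exact rogersl_div
      (mul_pos (hf.pos _ (hi ha (hi hb hX))) (hf.pos _ (hi hc hX)))
      (mul_pos (hf.pos _ (hi hb hX)) (hf.pos _ (hi ha (hi hc hX))))
      (hf.three_term X a b c hX ha hc hab hbc haX hbX hcX)
  have hi : ∀ {x : ℕ} {S : Finset ℕ}, x ∈ Finset.Icc 1 n → S ⊆ Finset.Icc 1 n →
    insert x S ⊆ Finset.Icc 1 n := fun h h' => Finset.insert_subset h h'
  have nm : ∀ {x y : ℕ}, x ≠ y → x ∉ Z → x ∉ insert y Z := fun h h' => by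
    simp [h, h']
  have t := hf.three_term
  have pos₁ : ∀ x ∈ Finset.Icc 1 n, 0 < f (insert x Z) := fun x hx => hf.pos _ (hi hx hZ)
  have pos₂ : ∀ x ∈ Finset.Icc 1 n, ∀ y ∈ Finset.Icc 1 n, 0 < f (insert x (insert y Z)) :=
    fun x hx y hy => hf.pos _ (hi hx (hi hy hZ))
  have pos₃ : ∀ x ∈ Finset.Icc 1 n, ∀ y ∈ Finset.Icc 1 n, ∀ z ∈ Finset.Icc 1 n,
      0 < f (insert x (insert y (insert z Z))) :=
    fun x hx y hy z hz => hf.pos _ (hi hx (hi hy (hi hz hZ)))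
  rw [key (insert s Z) p q r (hi hs' hZ) hp' hq' hr' hpq hqr (nm (by omega) hpZ)
      (nm (by omega) hqZ) (nm (by omega) hrZ),
    key Z p q s hZ hp' hq' hs' hpq (by omega) hpZ hqZ hsZ,
    key (insert q Z) p r s (hi hq' hZ) hp' hr' hs' (by omega) hrs (nm (by omega) hpZ)
      (nm (by omega) hrZ) (nm (by omega) hsZ),
    key Z q r s hZ hq' hr' hs' hqr hrs hqZ hrZ hsZ,
    key Z p q r hZ hp' hq' hr' hpq hqr hpZ hqZ hrZ,
    key (insert r Z) p q s (hi hr' hZ) hp' hq' hs' hpq (by omega) (nm (by omega) hpZ)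
      (nm (by omega) hqZ) (nm (by omega) hsZ),
    key Z p r s hZ hp' hr' hs' (by omega) hrs hpZ hrZ hsZ,
    key (insert p Z) q r s (hi hp' hZ) hq' hr' hs' hqr hrs (nm (by omega) hqZ)
      (nm (by omega) hrZ) (nm (by omega) hsZ)]
  have A := rogersL_three_term_aux (pos₁ p hp') (pos₁ q hq') (pos₁ r hr') (pos₁ s hs')
    (pos₂ p hp' q hq') (pos₂ p hp' r hr') (pos₂ p hp' s hs')
    (pos₂ q hq' r hr') (pos₂ q hq' s hs') (pos₂ r hr' s hs')
    (t Z p q s hZ hp' hs' hpq (by omega) hpZ hqZ hsZ)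
    (t Z p r s hZ hp' hs' (by omega) hrs hpZ hrZ hsZ)
    (t Z q r s hZ hq' hs' hqr hrs hqZ hrZ hsZ)
  have e1 := t (insert r Z) p q s (hi hr' hZ) hp' hs' hpq (by omega) (nm (by omega) hpZ)
      (nm (by omega) hqZ) (nm (by omega) hsZ)
  have e2 := t (insert q Z) p r s (hi hq' hZ) hp' hs' (by omega) hrs (nm (by omega) hpZ)
      (nm (by omega) hrZ) (nm (by omega) hsZ)
  have e3 := t (insert p Z) q r s (hi hp' hZ) hq' hs' hqr hrs (nm (by omega) hqZ)
      (nm (by omega) hrZ) (nm (by omega) hsZ)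
  -- The same lemma for complementary sets: the singletons become the triples omitting one label,
  -- and each pair becomes its complement in {p, q, r, s}.
  have B := rogersL_three_term_aux (pos₃ q hq' r hr' s hs') (pos₃ p hp' r hr' s hs')
    (pos₃ p hp' q hq' s hs') (pos₃ p hp' q hq' r hr') (pos₂ r hr' s hs') (pos₂ q hq' s hs')
    (pos₂ q hq' r hr') (pos₂ p hp' s hs') (pos₂ p hp' r hr') (pos₂ p hp' q hq')
  simp only [Finset.insert_comm q p, Finset.insert_comm r p, Finset.insert_comm s p,
    Finset.insert_comm r q, Finset.insert_comm s q, Finset.insert_comm s r] at e1 e2 e3 ⊢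
  specialize B (by linarith) (by linarith) (by linarith)
  simp only [mul_comm (f (insert q (insert r (insert s Z)))),
    mul_comm (f (insert p (insert r (insert s Z)))),
    mul_comm (f (insert p (insert q (insert s Z)))),
    mul_comm (f (insert r (insert s Z))) (f (insert p (insert q Z))),
    mul_comm (f (insert q (insert s Z))) (f (insert p (insert r Z)))] at B ⊢
  -- The extra term f(pq) f(rs) / (f(pr) f(qs)) is invariant under complementation, hence cancels in
  -- A - B.
  linear_combination 6 / Real.pi ^ 2 * (A - B)

/-! ### Telescoping between the two extreme contexts. -/

/-- The context of the triple `a < b < c` after the packets `{a, b, c, d}` with `d ≤ m` have been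
reversed. -/
def exchangeContext (n m a b c : ℕ) : Finset ℕ :=
  (Finset.Icc 1 n).filter fun d =>
    (d ≤ m ∧ (d < a ∨ b < d ∧ d < c)) ∨ (m < d ∧ (a < d ∧ d < b ∨ c < d))

theorem sum_Icc_one_sub (h : ℕ → ℝ) (n : ℕ) :
    ∑ d ∈ Finset.Icc 1 n, (h (d - 1) - h d) = h 0 - h n := by
  induction n with
  | zero => simp
  | succ n ih => rw [Finset.sum_Icc_succ_top (by omega), ih]; simp

/-- Quadruples `1 ≤ p < q < r < s ≤ n`. -/
def quadruples (n : ℕ) : Finset (ℕ × ℕ × ℕ × ℕ) :=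
  (Finset.Icc 1 n ×ˢ Finset.Icc 1 n ×ˢ Finset.Icc 1 n ×ˢ Finset.Icc 1 n).filter
    fun x => x.1 < x.2.1 ∧ x.2.1 < x.2.2.1 ∧ x.2.2.1 < x.2.2.2

/-- A sum over triples and an additional element is a sum over quadruples. -/
theorem sum_tetrahedron_sum_Icc (n : ℕ) (g : ℕ → ℕ → ℕ → ℕ → ℝ)
    (ha : ∀ a b c, g a b c a = 0) (hb : ∀ a b c, g a b c b = 0) (hc : ∀ a b c, g a b c c = 0) :
    ∑ t ∈ tetrahedron n, ∑ d ∈ Finset.Icc 1 n, g t.1 t.2.1 t.2.2 d =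
      ∑ x ∈ quadruples n, (g x.2.1 x.2.2.1 x.2.2.2 x.1 + g x.1 x.2.2.1 x.2.2.2 x.2.1 +
        g x.1 x.2.1 x.2.2.2 x.2.2.1 + g x.1 x.2.1 x.2.2.1 x.2.2.2) := by
  set S := tetrahedron n ×ˢ Finset.Icc 1 n with hS
  let G : (ℕ × ℕ × ℕ) × ℕ → ℝ := fun x => g x.1.1 x.1.2.1 x.1.2.2 x.2
  have hsplit : ∀ x ∈ S, G x = (if x.2 < x.1.1 then G x else 0) +
      (if x.1.1 < x.2 ∧ x.2 < x.1.2.1 then G x else 0) +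
      (if x.1.2.1 < x.2 ∧ x.2 < x.1.2.2 then G x else 0) +
      (if x.1.2.2 < x.2 then G x else 0) := by
    rintro ⟨⟨a, b, c⟩, d⟩ hx
    simp only [hS, tetrahedron, Finset.mem_product, Finset.mem_filter, Finset.mem_Icc] at hx
    have key : d = a ∨ d = b ∨ d = c ∨ d < a ∨ (a < d ∧ d < b) ∨ (b < d ∧ d < c) ∨ c < d := by
      omega
    rcases key with rfl | rfl | rfl | h | h | h | h
    · simp [G, ha]
    · simp [G, hb]
    · simp [G, hc]
    · rw [if_pos h, if_neg (by simp only; omega), if_neg (by simp only; omega),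
        if_neg (by simp only; omega)]
      ring
    · rw [if_neg (by simp only; omega), if_pos h, if_neg (by simp only; omega),
        if_neg (by simp only; omega)]
      ring
    · rw [if_neg (by simp only; omega), if_neg (by simp only; omega), if_pos h,
        if_neg (by simp only; omega)]
      ring
    · rw [if_neg (by simp only; omega), if_neg (by simp only; omega),
        if_neg (by simp only; omega), if_pos h]
      ring
  rw [← Finset.sum_product' (tetrahedron n) (Finset.Icc 1 n)
    (fun t d => g t.1 t.2.1 t.2.2 d), Finset.sum_congr rfl hsplit]
  simp only [Finset.sum_add_distrib, ← Finset.sum_filter]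
  congr 1
  · congr 1
    · congr 1
      · refine Finset.sum_nbij' (fun x => (x.2, x.1.1, x.1.2.1, x.1.2.2))
          (fun x => ((x.2.1, x.2.2.1, x.2.2.2), x.1)) ?_ ?_ ?_ ?_ ?_
        · simp only [hS, quadruples, tetrahedron, Finset.mem_product, Finset.mem_filter,
            Finset.mem_Icc]; omega
        · simp only [hS, quadruples, tetrahedron, Finset.mem_product, Finset.mem_filter,
            Finset.mem_Icc]; omega
        all_goals intros; rfl
      · refine Finset.sum_nbij' (fun x => (x.1.1, x.2, x.1.2.1, x.1.2.2))
          (fun x => ((x.1, x.2.2.1, x.2.2.2), x.2.1)) ?_ ?_ ?_ ?_ ?_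
        · simp only [hS, quadruples, tetrahedron, Finset.mem_product, Finset.mem_filter,
            Finset.mem_Icc]; omega
        · simp only [hS, quadruples, tetrahedron, Finset.mem_product, Finset.mem_filter,
            Finset.mem_Icc]; omega
        all_goals intros; rfl
    · refine Finset.sum_nbij' (fun x => (x.1.1, x.1.2.1, x.2, x.1.2.2))
        (fun x => ((x.1, x.2.1, x.2.2.2), x.2.2.1)) ?_ ?_ ?_ ?_ ?_
      · simp only [hS, quadruples, tetrahedron, Finset.mem_product, Finset.mem_filter,
          Finset.mem_Icc]; omega
      · simp only [hS, quadruples, tetrahedron, Finset.mem_product, Finset.mem_filter,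
          Finset.mem_Icc]; omega
      all_goals intros; rfl
  · refine Finset.sum_nbij' (fun x => (x.1.1, x.1.2.1, x.1.2.2, x.2))
      (fun x => ((x.1, x.2.1, x.2.2.1), x.2.2.2)) ?_ ?_ ?_ ?_ ?_
    · simp only [hS, quadruples, tetrahedron, Finset.mem_product, Finset.mem_filter,
        Finset.mem_Icc]; omega
    · simp only [hS, quadruples, tetrahedron, Finset.mem_product, Finset.mem_filter,
        Finset.mem_Icc]; omega
    all_goals intros; rfl

theorem exchangeContext_sub_one_self {n a b c d : ℕ} (h : d = a ∨ d = b ∨ d = c)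
    (hab : a < b) (hbc : b < c) :
    exchangeContext n (d - 1) a b c = exchangeContext n d a b c := by
  ext x
  simp only [exchangeContext, Finset.mem_filter, Finset.mem_Icc]
  omega

/-- The two extreme sequences of exchanges have the same sum of dilogarithms. -/
theorem IsPositiveFlag.sum_exchangeRatio_eq {n : ℕ} {f : Finset ℕ → ℝ}
    (hf : IsPositiveFlag n f) :
    dilogSum n (fun a b c => exchangeRatio f (exchangeContext n 0 a b c) a b c) =
      dilogSum n (fun a b c => exchangeRatio f (exchangeContext n n a b c) a b c) := by
  let H : ℕ → ℕ → ℕ → ℕ → ℝ := fun m a b c =>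
    rogersl (exchangeRatio f (exchangeContext n m a b c) a b c)
  -- The guard makes g vanish for unordered triples, so that vanishing at d ∈ {a, b, c} holds
  -- without order hypotheses.
  let g : ℕ → ℕ → ℕ → ℕ → ℝ := fun a b c d =>
    if a < b ∧ b < c then H (d - 1) a b c - H d a b c else 0
  have hz : ∀ a b c d, (d = a ∨ d = b ∨ d = c) → g a b c d = 0 := by
    intro a b c d hd
    by_cases h : a < b ∧ b < c
    · simp only [g, H, if_pos h, exchangeContext_sub_one_self hd h.1 h.2, sub_self]
    · simp only [g, if_neg h]
  unfold dilogSum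
  rw [← sub_eq_zero, ← Finset.sum_sub_distrib]
  have hT : ∀ t ∈ tetrahedron n, H 0 t.1 t.2.1 t.2.2 - H n t.1 t.2.1 t.2.2 =
      ∑ d ∈ Finset.Icc 1 n, g t.1 t.2.1 t.2.2 d := by
    intro t ht
    rw [← sum_Icc_one_sub (fun m => H m t.1 t.2.1 t.2.2)]
    exact Finset.sum_congr rfl fun d _ => (if_pos (Finset.mem_filter.1 ht).2).symm
  refine (Finset.sum_congr rfl hT).trans ?_
  rw [sum_tetrahedron_sum_Icc n g (fun a b c => hz _ _ _ _ (Or.inl rfl))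
    (fun a b c => hz _ _ _ _ (Or.inr (Or.inl rfl)))
    (fun a b c => hz _ _ _ _ (Or.inr (Or.inr rfl)))]
  refine Finset.sum_eq_zero ?_
  rintro ⟨p, q, r, s⟩ hx
  simp only [quadruples, Finset.mem_product, Finset.mem_filter, Finset.mem_Icc] at hx
  obtain ⟨⟨hp, hq, hr, hs⟩, hpq, hqr, hrs⟩ := hx
  -- Although the four changes indexed by this quadruple occur at the different levels p, q, r, s,
  -- they share this context Z outside the quadruple. This is what makes the four-term identity
  -- applicable.
  set Z := (Finset.Icc 1 n).filter fun d => d < p ∨ (q < d ∧ d < r) ∨ s < d with hZ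
  have c1 : exchangeContext n (p - 1) q r s = Z := by
    ext x; simp only [exchangeContext, hZ, Finset.mem_filter, Finset.mem_Icc]; omega
  have c1' : exchangeContext n p q r s = insert p Z := by
    ext x
    simp only [exchangeContext, hZ, Finset.mem_filter, Finset.mem_Icc, Finset.mem_insert]; omega
  have c2 : exchangeContext n (q - 1) p r s = insert q Z := by
    ext x
    simp only [exchangeContext, hZ, Finset.mem_filter, Finset.mem_Icc, Finset.mem_insert]; omega
  have c2' : exchangeContext n q p r s = Z := by
    ext x; simp only [exchangeContext, hZ, Finset.mem_filter, Finset.mem_Icc]; omega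
  have c3 : exchangeContext n (r - 1) p q s = Z := by
    ext x; simp only [exchangeContext, hZ, Finset.mem_filter, Finset.mem_Icc]; omega
  have c3' : exchangeContext n r p q s = insert r Z := by
    ext x
    simp only [exchangeContext, hZ, Finset.mem_filter, Finset.mem_Icc, Finset.mem_insert]; omega
  have c4 : exchangeContext n (s - 1) p q r = insert s Z := by
    ext x
    simp only [exchangeContext, hZ, Finset.mem_filter, Finset.mem_Icc, Finset.mem_insert]; omega
  have c4' : exchangeContext n s p q r = Z := by
    ext x; simp only [exchangeContext, hZ, Finset.mem_filter, Finset.mem_Icc]; omega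
  have h4 := hf.four_term (Z := Z) (Finset.filter_subset _ _) hp.1 hpq hqr hrs hs.2
    (by simp only [hZ, Finset.mem_filter]; omega) (by simp only [hZ, Finset.mem_filter]; omega)
    (by simp only [hZ, Finset.mem_filter]; omega) (by simp only [hZ, Finset.mem_filter]; omega)
  simp only [g, H, if_pos (And.intro hqr hrs), if_pos (And.intro (hpq.trans hqr) hrs),
    if_pos (And.intro hpq (hqr.trans hrs)), if_pos (And.intro hpq hqr), c1, c1', c2, c2', c3, c3',
    c4, c4']
  linarith

/-! ### Three-term Plücker relations for determinants. -/

/-- The three-term Plücker relation for the columns in positions `p` and `q`. -/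
theorem Matrix.det_mul_det_updateCol_updateCol {ι R : Type*} [Fintype ι] [DecidableEq ι]
    [CommRing R] (A : Matrix ι ι R) {p q : ι} (hpq : p ≠ q) (b e : ι → R) :
    A.det * ((A.updateCol q e).updateCol p b).det =
      (A.updateCol p b).det * (A.updateCol q e).det +
        (A.updateCol q b).det * ((A.updateCol q e).updateCol p (fun i => A i q)).det := by
  -- Cramer's rule expands det(A) · b in the columns of A; substituting this into column p of the
  -- second determinant gives the sum.
  have hb : A.det • b = ∑ i, (A.updateCol i b).det • fun k => A k i := by
    rw [← Matrix.mulVec_cramer]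
    ext k
    simp only [Matrix.mulVec, dotProduct, Finset.sum_apply, Pi.smul_apply, smul_eq_mul,
      Matrix.cramer_apply]
    exact Finset.sum_congr rfl fun i _ => mul_comm _ _
  have hlin : ∀ v, ((A.updateCol q e).updateCol p v).det =
      Matrix.cramer (A.updateCol q e) v p := fun v => (Matrix.cramer_apply _ _ _).symm
  -- For other i the column occurs twice, so only the terms i = p and i = q survive.
  have h0 : ∀ i, i ≠ p → i ≠ q → ((A.updateCol q e).updateCol p (fun k => A k i)).det = 0 := by
    intro i hip hiq
    refine Matrix.det_zero_of_column_eq (i := p) (j := i) hip.symm fun k => ?_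
    simp [hip, hiq]
  have hp : (A.updateCol q e).updateCol p (fun k => A k p) = A.updateCol q e := by
    ext k j
    rcases eq_or_ne j p with rfl | hj
    · simp [hpq]
    · simp [Matrix.updateCol_apply, hj]
  have key : A.det * ((A.updateCol q e).updateCol p b).det =
      ∑ i, (A.updateCol i b).det * ((A.updateCol q e).updateCol p (fun k => A k i)).det := by
    simp only [hlin]
    rw [← smul_eq_mul, ← Pi.smul_apply, ← map_smul, hb, map_sum, Finset.sum_apply]
    simp
  rw [key, ← Finset.add_sum_erase _ _ (Finset.mem_univ p),
    ← Finset.add_sum_erase _ _ (Finset.mem_erase.2 ⟨hpq.symm, Finset.mem_univ q⟩), hp,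
    Finset.sum_eq_zero, add_zero]
  intro i hi
  simp only [Finset.mem_erase] at hi
  rw [h0 i hi.2.1 hi.1, mul_zero]

/-- The matrix `(u, v, N)` with two columns put in front of `N`. -/
def consTwoCols {R : Type*} {m k : ℕ} (u v : Fin m → R) (N : Matrix (Fin m) (Fin k) R) :
    Matrix (Fin m) (Fin (k + 2)) R :=
  Matrix.of fun i => Fin.cons (u i) (Fin.cons (v i) (N i))

theorem det_consTwoCols_plucker {R : Type*} [CommRing R] {k : ℕ}
    (N : Matrix (Fin (k + 2)) (Fin k) R) (u v b e : Fin (k + 2) → R) :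
    (consTwoCols u v N).det * (consTwoCols b e N).det =
      (consTwoCols b v N).det * (consTwoCols u e N).det +
        (consTwoCols u b N).det * (consTwoCols v e N).det := by
  have h := Matrix.det_mul_det_updateCol_updateCol (consTwoCols u v N) (p := 0) (q := 1)
    (by simp) b e
  have h0 : ∀ u v b, (consTwoCols u v N).updateCol 0 b = consTwoCols b v N := by
    intro u v b
    ext i j
    refine Fin.cases ?_ (fun j => ?_) j
    · simp [consTwoCols]
    · simp [consTwoCols]
  have h1 : ∀ u v b, (consTwoCols u v N).updateCol 1 b = consTwoCols u b N := by
    intro u v b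
    ext i j
    refine Fin.cases ?_ (fun j => Fin.cases ?_ (fun j => ?_) j) j
    · simp [consTwoCols]
    · simp [consTwoCols]
    · simp [consTwoCols, Fin.ext_iff]
  simpa only [h0, h1, show (fun i => consTwoCols u v N i 1) = v from rfl] using h

/-- A unit column deletes a row, and bringing column c to the front costs (-1)^c. With the next
lemma this rewrites the Plücker relation for maximal minors as one between minors of different
sizes. -/
theorem det_consTwoCols_single {R : Type*} [CommRing R] {k : ℕ}
    (N : Matrix (Fin (k + 2)) (Fin (k + 1)) R) (c : Fin (k + 1)) (p : Fin (k + 2)) :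
    (consTwoCols (Pi.single p 1) (fun i => N i c) (N.submatrix id c.succAbove)).det =
      (-1) ^ (p + c : ℕ) * (N.submatrix p.succAbove id).det := by
  rw [Matrix.det_succ_column_zero, Finset.sum_eq_single p]
  · rw [Matrix.det_succ_column (N.submatrix p.succAbove id) c, Matrix.det_succ_column_zero]
    simp only [consTwoCols, Matrix.of_apply, Fin.cons_zero, Pi.single_eq_same, mul_one,
      Finset.mul_sum]
    refine Finset.sum_congr rfl fun i _ => ?_
    simp only [Matrix.submatrix_apply, Matrix.of_apply, Fin.cons_succ, Fin.cons_zero, id,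
      Matrix.submatrix_submatrix]
    have hm : (Matrix.of fun i => (Fin.cons ((Pi.single p 1 : Fin (k + 2) → R) i)
        (Fin.cons (N i c) ((N.submatrix id c.succAbove) i) : Fin (k + 1) → R) :
          Fin (k + 2) → R)).submatrix (p.succAbove ∘ i.succAbove) (Fin.succ ∘ Fin.succ) =
        N.submatrix (p.succAbove ∘ i.succAbove) (id ∘ c.succAbove) := by
      ext; simp
    rw [hm]
    have hc : ((-1 : R) ^ (c : ℕ)) * (-1) ^ (c : ℕ) = 1 := by
      rw [← mul_pow]; simp
    simp only [pow_add]
    linear_combination (-(-1 : R) ^ (p : ℕ) * (-1) ^ (i : ℕ) * N (p.succAbove i) c *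
      (N.submatrix (p.succAbove ∘ i.succAbove) (id ∘ c.succAbove)).det) * hc
  · intro i _ hi
    simp [consTwoCols, hi]
  · simp

theorem det_consTwoCols_single_single {R : Type*} [CommRing R] {k : ℕ}
    (N : Matrix (Fin (k + 2)) (Fin k) R) (p : Fin (k + 2)) (r : Fin (k + 1)) :
    (consTwoCols (Pi.single p 1) (Pi.single (p.succAbove r) 1) N).det =
      (-1) ^ (p + r : ℕ) * (N.submatrix (p.succAbove ∘ r.succAbove) id).det := by
  rw [Matrix.det_succ_column_zero, Finset.sum_eq_single p]
  · rw [Matrix.det_succ_column_zero, Finset.sum_eq_single r]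
    · rw [pow_add]
      simp only [consTwoCols, Matrix.of_apply, Fin.cons_zero, Pi.single_eq_same, mul_one,
        Matrix.submatrix_apply, Fin.cons_succ, mul_assoc]
      congr 1
    · intro i _ hi
      simp [consTwoCols, hi]
    · simp
  · intro i _ hi
    simp [consTwoCols, hi]
  · simp

/-- Three-term relation between maximal minors of `N` and of `N` without one column; the rows `p`,
`q`, `r` are the ones removed. -/
theorem det_three_term_succAbove {R : Type*} [CommRing R] {k : ℕ}
    (N : Matrix (Fin (k + 2)) (Fin (k + 1)) R) (c : Fin (k + 1)) {p q r : Fin (k + 2)}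
    {q₀ r₀ : Fin (k + 1)} (hpq : p < q) (hqr : q < r) (hq₀ : (q₀ : ℕ) + 1 = q)
    (hr₀ : (r₀ : ℕ) + 1 = r) :
    (N.submatrix (p.succAbove ∘ r₀.succAbove) c.succAbove).det *
        (N.submatrix q.succAbove id).det =
      (N.submatrix r.succAbove id).det *
          (N.submatrix (p.succAbove ∘ q₀.succAbove) c.succAbove).det +
        (N.submatrix (q.succAbove ∘ r₀.succAbove) c.succAbove).det *
          (N.submatrix p.succAbove id).det := by
  have hpr : p.succAbove r₀ = r := by
    rw [Fin.succAbove_of_le_castSucc _ _ (by simp only [Fin.le_def, Fin.val_castSucc]; omega)]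
    exact Fin.ext (by simpa using hr₀)
  have hqr' : q.succAbove r₀ = r := by
    rw [Fin.succAbove_of_le_castSucc _ _ (by simp only [Fin.le_def, Fin.val_castSucc]; omega)]
    exact Fin.ext (by simpa using hr₀)
  have hpq' : p.succAbove q₀ = q := by
    rw [Fin.succAbove_of_le_castSucc _ _ (by simp only [Fin.le_def, Fin.val_castSucc]; omega)]
    exact Fin.ext (by simpa using hq₀)
  -- The four free columns are the unit vectors at p, r, q and the removed column c.
  have h := det_consTwoCols_plucker (N.submatrix id c.succAbove) (Pi.single p 1) (Pi.single r 1)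
    (Pi.single q 1) (fun i => N i c)
  have e1 := det_consTwoCols_single_single (N.submatrix id c.succAbove) p r₀
  have e2 := det_consTwoCols_single_single (N.submatrix id c.succAbove) p q₀
  have e3 := det_consTwoCols_single_single (N.submatrix id c.succAbove) q r₀
  rw [hpr] at e1
  rw [hpq'] at e2
  rw [hqr'] at e3
  simp only [Matrix.submatrix_submatrix, Function.id_comp, Function.comp_id] at e1 e2 e3
  rw [e1, e2, e3, det_consTwoCols_single, det_consTwoCols_single, det_consTwoCols_single, ← hq₀,
    ← hr₀] at h
  have hs : ∀ m : ℕ, ((-1 : R) ^ m) * (-1) ^ m = 1 := fun m => by rw [← mul_pow]; simp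
  -- Since q = q₀ + 1 and r = r₀ + 1, all three products carry this same sign.
  have hu : IsUnit ((-1 : R) ^ ((p : ℕ) + q₀ + r₀ + c + 1)) := (isUnit_one.neg).pow _
  refine hu.mul_left_cancel ?_
  simp only [pow_add, pow_one] at h ⊢
  linear_combination h

theorem Finset.orderEmbOfFin_comp {α : Type*} [LinearOrder α] {S T : Finset α} {k m : ℕ}
    (hS : S.card = k) (hT : T.card = m) (g : Fin m → Fin k) (hg : StrictMono g)
    (h : ∀ i, S.orderEmbOfFin hS (g i) ∈ T) :
    ⇑(T.orderEmbOfFin hT) = S.orderEmbOfFin hS ∘ g :=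
  (Finset.orderEmbOfFin_unique hT h ((S.orderEmbOfFin hS).strictMono.comp hg)).symm

/-- The three-term relation between minors with sorted rows. -/
theorem det_three_term {α R : Type*} [LinearOrder α] [CommRing R] {k : ℕ}
    (N : Matrix α (Fin (k + 2)) R) (j : Fin (k + 2)) {X : Finset α} {a b c : α}
    (hab : a < b) (hbc : b < c) (haX : a ∉ X)
    (ha : (insert a X).card = k + 1) (hb : (insert b X).card = k + 1)
    (hc : (insert c X).card = k + 1) (hab' : (insert a (insert b X)).card = k + 2)
    (hac' : (insert a (insert c X)).card = k + 2) (hbc' : (insert b (insert c X)).card = k + 2) :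
    (N.submatrix ((insert b X).orderEmbOfFin hb) j.succAbove).det *
        (N.submatrix ((insert a (insert c X)).orderEmbOfFin hac') id).det =
      (N.submatrix ((insert a (insert b X)).orderEmbOfFin hab') id).det *
          (N.submatrix ((insert c X).orderEmbOfFin hc) j.succAbove).det +
        (N.submatrix ((insert a X).orderEmbOfFin ha) j.succAbove).det *
          (N.submatrix ((insert b (insert c X)).orderEmbOfFin hbc') id).det := by
  have hS : (insert a (insert b (insert c X))).card = k + 3 := by
    rw [Finset.card_insert_of_notMem, hbc']
    simp [hab.ne, (hab.trans hbc).ne, haX]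
  -- All six row sets arise from S by deleting one or two of a, b, c; positions in S reduce the
  -- claim to `det_three_term_succAbove`.
  set S := insert a (insert b (insert c X)) with hSdef
  set s := S.orderEmbOfFin hS with hs
  have hrange : ∀ x ∈ S, ∃ i, s i = x := by
    intro x hx
    have : x ∈ Set.range s := by rw [hs, Finset.range_orderEmbOfFin]; exact hx
    exact this
  have hmem : ∀ i, s i ∈ S := fun i => Finset.orderEmbOfFin_mem S hS i
  obtain ⟨p, hp⟩ := hrange a (by simp [hSdef])
  obtain ⟨q, hq⟩ := hrange b (by simp [hSdef])
  obtain ⟨r, hr⟩ := hrange c (by simp [hSdef])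
  have hpq : p < q := by rw [← s.lt_iff_lt, hp, hq]; exact hab
  have hqr : q < r := by rw [← s.lt_iff_lt, hq, hr]; exact hbc
  have hsub : ∀ x : Fin (k + 3), p < x → ∃ y : Fin (k + 2), (y : ℕ) + 1 = x := fun x hx =>
    ⟨⟨x - 1, by have := x.2; omega⟩, by have : (p : ℕ) < x := hx; simp only; omega⟩
  obtain ⟨q₀, hq₀⟩ := hsub q hpq
  obtain ⟨r₀, hr₀⟩ := hsub r (hpq.trans hqr)
  have hsA : ∀ x y : Fin (k + 3), ∀ y₀ : Fin (k + 2), x < y → (y₀ : ℕ) + 1 = y →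
      x.succAbove y₀ = y := by
    intro x y y₀ hxy hy
    rw [Fin.succAbove_of_le_castSucc _ _ (by simp only [Fin.le_def, Fin.val_castSucc]; omega)]
    exact Fin.ext (by simpa using hy)
  have hinj : ∀ {x y}, x ≠ y → s x ≠ s y := fun h => s.injective.ne h
  have one : ∀ (x : Fin (k + 3)) (i : Fin (k + 2)), s (x.succAbove i) ≠ s x :=
    fun x i => hinj (Fin.succAbove_ne x i)
  have two : ∀ (x y : Fin (k + 3)) (y₀ : Fin (k + 2)) (i : Fin (k + 1)), x < y →
      (y₀ : ℕ) + 1 = y → s (x.succAbove (y₀.succAbove i)) ≠ s y := by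
    intro x y y₀ i hxy hy
    rw [← hsA x y y₀ hxy hy]
    exact hinj ((Fin.succAbove_right_injective).ne (Fin.succAbove_ne y₀ i))
  have mono : ∀ x : Fin (k + 3), StrictMono x.succAbove := Fin.strictMono_succAbove
  have mono' : ∀ x : Fin (k + 2), StrictMono x.succAbove := Fin.strictMono_succAbove
  have E : ∀ {x}, x ∈ S ↔ x = a ∨ x = b ∨ x = c ∨ x ∈ X := by simp [hSdef]
  have e1 := Finset.orderEmbOfFin_comp hS hb (p.succAbove ∘ r₀.succAbove)
    ((mono p).comp (mono' r₀)) (fun i => by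
      have h1 := one p (r₀.succAbove i)
      have h2 := two p r r₀ i (hpq.trans hqr) hr₀
      have h3 := E.1 (hmem (p.succAbove (r₀.succAbove i)))
      rw [hp] at h1; rw [hr] at h2
      rw [Finset.mem_insert]; tauto)
  have e2 := Finset.orderEmbOfFin_comp hS hc (p.succAbove ∘ q₀.succAbove)
    ((mono p).comp (mono' q₀)) (fun i => by
      have h1 := one p (q₀.succAbove i)
      have h2 := two p q q₀ i hpq hq₀
      have h3 := E.1 (hmem (p.succAbove (q₀.succAbove i)))
      rw [hp] at h1; rw [hq] at h2
      rw [Finset.mem_insert]; tauto)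
  have e3 := Finset.orderEmbOfFin_comp hS ha (q.succAbove ∘ r₀.succAbove)
    ((mono q).comp (mono' r₀)) (fun i => by
      have h1 := one q (r₀.succAbove i)
      have h2 := two q r r₀ i hqr hr₀
      have h3 := E.1 (hmem (q.succAbove (r₀.succAbove i)))
      rw [hq] at h1; rw [hr] at h2
      rw [Finset.mem_insert]; tauto)
  have e4 := Finset.orderEmbOfFin_comp hS hac' q.succAbove (mono q) (fun i => by
      have h1 := one q i
      have h3 := E.1 (hmem (q.succAbove i))
      rw [hq] at h1
      rw [Finset.mem_insert, Finset.mem_insert]; tauto)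
  have e5 := Finset.orderEmbOfFin_comp hS hab' r.succAbove (mono r) (fun i => by
      have h1 := one r i
      have h3 := E.1 (hmem (r.succAbove i))
      rw [hr] at h1
      rw [Finset.mem_insert, Finset.mem_insert]; tauto)
  have e6 := Finset.orderEmbOfFin_comp hS hbc' p.succAbove (mono p) (fun i => by
      have h1 := one p i
      have h3 := E.1 (hmem (p.succAbove i))
      rw [hp] at h1
      rw [Finset.mem_insert, Finset.mem_insert]; tauto)
  rw [e1, e2, e3, e4, e5, e6]
  exact det_three_term_succAbove (N.submatrix s id) j hpq hqr hq₀ hr₀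

/-! ### Flag minors of totally positive unitriangular matrices. -/

theorem rightFlagMinor_eq {n m : ℕ} (M : Matrix (Fin n) (Fin n) ℝ) {I : Finset ℕ}
    (f g : Fin m → Fin n) (hf : StrictMono f) (hI : ∀ x : Fin n, (x : ℕ) + 1 ∈ I ↔ ∃ i, f i = x)
    (hg : ∀ j, (g j : ℕ) = n - m + j) :
    rightFlagMinor M I = (M.submatrix f g).det := by
  have hlab : labelSet n I = Finset.univ.image f := by
    ext x
    simp [labelSet, hI]
  have hm : m = (labelSet n I).card := by
    rw [hlab, Finset.card_image_of_injective _ hf.injective, Finset.card_univ, Fintype.card_fin]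
  subst hm
  have hf' := Finset.orderEmbOfFin_unique (s := labelSet n I) rfl (f := f)
    (fun i => by rw [hlab]; exact Finset.mem_image_of_mem _ (Finset.mem_univ _)) hf
  rw [rightFlagMinor, hf']
  congr 2
  ext j
  simp [hg]

theorem upperFlagMinor_eq {n m : ℕ} (M : Matrix (Fin n) (Fin n) ℝ) {I : Finset ℕ}
    (f g : Fin m → Fin n) (hf : StrictMono f) (hI : ∀ x : Fin n, (x : ℕ) + 1 ∈ I ↔ ∃ i, f i = x)
    (hg : ∀ j, (g j : ℕ) = j) :
    upperFlagMinor M I = (M.submatrix g f).det := by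
  have hlab : labelSet n I = Finset.univ.image f := by
    ext x
    simp [labelSet, hI]
  have hm : m = (labelSet n I).card := by
    rw [hlab, Finset.card_image_of_injective _ hf.injective, Finset.card_univ, Fintype.card_fin]
  subst hm
  have hf' := Finset.orderEmbOfFin_unique (s := labelSet n I) rfl (f := f)
    (fun i => by rw [hlab]; exact Finset.mem_image_of_mem _ (Finset.mem_univ _)) hf
  rw [upperFlagMinor, hf']
  congr 2
  ext j
  simp [hg]

/-- A minor of an upper triangular matrix vanishes unless the rows are bounded by the columns. -/
theorem IsUpperUnitriangular.det_submatrix_eq_zero {n k : ℕ} {H : Matrix (Fin n) (Fin n) ℝ}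
    (hH : IsUpperUnitriangular H) {I J : Fin k → Fin n} (hI : Monotone I) (hJ : Monotone J)
    {i : Fin k} (hi : J i < I i) : (H.submatrix I J).det = 0 := by
  rw [Matrix.det_apply]
  refine Finset.sum_eq_zero fun σ _ => ?_
  -- By pigeonhole σ cannot send the indices up to i injectively below i, so each term of the
  -- expansion has an entry below the diagonal.
  have hex : ∃ j, j ≤ i ∧ i ≤ σ j := by
    by_contra! hcon
    have hmaps : ∀ j ∈ Finset.Iic i, σ j ∈ Finset.Iio i := fun j hj =>
      Finset.mem_Iio.2 (hcon j (Finset.mem_Iic.1 hj))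
    have := Finset.card_le_card_of_injOn σ hmaps σ.injective.injOn
    simp at this
  obtain ⟨j, hj, hij⟩ := hex
  rw [Finset.prod_eq_zero (Finset.mem_univ j), smul_zero]
  exact hH.1 _ _ ((hJ hj).trans_lt (hi.trans_le (hI hij)))

/-- Put ones on the diagonal and at the positions (I l, J l): because I ≤ J, the chosen submatrix is
lower unitriangular. -/
theorem exists_det_submatrix_ne_zero {n k : ℕ} {I J : Fin k → Fin n} (hI : StrictMono I)
    (hJ : StrictMono J) (h : ∀ i, I i ≤ J i) :
    ∃ H : Matrix (Fin n) (Fin n) ℝ, IsUpperUnitriangular H ∧ (H.submatrix I J).det ≠ 0 := by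
  classical
  let H : Matrix (Fin n) (Fin n) ℝ := Matrix.of fun i j =>
    if i = j ∨ ∃ l, I l = i ∧ J l = j then 1 else 0
  refine ⟨H, ⟨fun i j hij => ?_, fun i => by simp [H]⟩, ?_⟩
  · simp only [H, Matrix.of_apply]
    rw [if_neg]
    rintro (rfl | ⟨l, rfl, rfl⟩)
    · exact lt_irrefl _ hij
    · exact absurd (h l) (not_le.2 hij)
  · rw [Matrix.det_of_isLowerTriangular, Finset.prod_eq_one]
    · simp
    · intro i _
      exact if_pos (Or.inr ⟨i, rfl, rfl⟩)
    · intro i j hij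
      have hij : i < j := hij
      simp only [H, Matrix.submatrix_apply, Matrix.of_apply]
      rw [if_neg]
      rintro (he | ⟨l, h1, h2⟩)
      · have h1 := h j
        rw [← he] at h1
        exact absurd (hI.le_iff_le.1 h1) (not_le.2 hij)
      · rw [hI.injective h1] at h2
        exact hij.ne (hJ.injective h2)

/-- The minors not vanishing identically are exactly those whose sorted rows are bounded entrywise
by the sorted columns. -/
theorem isTotallyPositiveUnitriangular_iff {n : ℕ} {M : Matrix (Fin n) (Fin n) ℝ} :
    IsTotallyPositiveUnitriangular M ↔ IsUpperUnitriangular M ∧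
      ∀ (k : ℕ) (I J : Fin k → Fin n), StrictMono I → StrictMono J → (∀ i, I i ≤ J i) →
        0 < (M.submatrix I J).det := by
  refine and_congr_right fun _ => ⟨fun h k I J hI hJ hIJ => ?_, fun h k I J hH => ?_⟩
  · exact h k (OrderEmbedding.ofStrictMono I hI) (OrderEmbedding.ofStrictMono J hJ)
      (exists_det_submatrix_ne_zero hI hJ hIJ)
  · obtain ⟨H, hH, hne⟩ := hH
    refine h k I J I.strictMono J.strictMono fun i => ?_
    by_contra hi
    exact hne (hH.det_submatrix_eq_zero I.monotone J.monotone (not_le.1 hi))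

theorem StrictMono.val_add_le {n m : ℕ} {f : Fin m → Fin n} (hf : StrictMono f) (i : Fin m) :
    (f i : ℕ) + m ≤ n + i := by
  have key : ∀ d : ℕ, ∀ i : Fin m, (i : ℕ) + d + 1 = m → (f i : ℕ) + d + 1 ≤ n := by
    intro d
    induction d with
    | zero => intro i _; have := (f i).2; omega
    | succ d ih =>
      intro i hi
      have h1 := ih ⟨i + 1, by omega⟩ (by simp only; omega)
      have h2 : f i < f ⟨i + 1, by omega⟩ := hf (by simp [Fin.lt_def])
      have h2' : (f i : ℕ) < f ⟨i + 1, by omega⟩ := h2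
      omega
  have := key (m - 1 - i) i (by have := i.2; omega)
  have := i.2
  omega

theorem IsTotallyPositiveUnitriangular.rightFlagMinor_pos {n : ℕ} {M : Matrix (Fin n) (Fin n) ℝ}
    (hM : IsTotallyPositiveUnitriangular M) (I : Finset ℕ) : 0 < rightFlagMinor M I := by
  have hcard := labelSet_card_le n I
  refine (isTotallyPositiveUnitriangular_iff.1 hM).2 _ _ _ (OrderEmbedding.strictMono _) ?_ ?_
  · intro i j hij
    have : (i : ℕ) < j := hij
    simp only [Fin.lt_def]
    omega
  · intro i
    have := ((labelSet n I).orderEmbOfFin rfl).strictMono.val_add_le i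
    simp only [Fin.le_def]
    omega

theorem labelSet_insert {n a : ℕ} (ha : a ∈ Finset.Icc 1 n) (X : Finset ℕ) :
    labelSet n (insert a X) =
      insert (⟨a - 1, by rw [Finset.mem_Icc] at ha; omega⟩ : Fin n) (labelSet n X) := by
  rw [Finset.mem_Icc] at ha
  ext x
  simp only [labelSet, Finset.mem_filter, Finset.mem_univ, true_and, Finset.mem_insert,
    Fin.ext_iff]
  refine or_congr_left ?_
  omega

theorem rightFlagMinor_eq_of_labelSet_eq {n m : ℕ} (M : Matrix (Fin n) (Fin n) ℝ) {I : Finset ℕ}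
    {S : Finset (Fin n)} (hS : labelSet n I = S) (hm : S.card = m) (g : Fin m → Fin n)
    (hg : ∀ j, (g j : ℕ) = n - m + j) :
    rightFlagMinor M I = (M.submatrix (S.orderEmbOfFin hm) g).det := by
  refine rightFlagMinor_eq M _ g (OrderEmbedding.strictMono _) (fun x => ?_) hg
  have : x ∈ Set.range (S.orderEmbOfFin hm) ↔ x ∈ S := by
    rw [Finset.range_orderEmbOfFin, Finset.mem_coe]
  rw [← Set.mem_range, this, ← hS]
  simp [labelSet]

theorem IsTotallyPositiveUnitriangular.isPositiveFlag {n : ℕ} {M : Matrix (Fin n) (Fin n) ℝ}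
    (hM : IsTotallyPositiveUnitriangular M) : IsPositiveFlag n (rightFlagMinor M) where
  pos I _ := hM.rightFlagMinor_pos I
  three_term := by
    intro X a b c hX ha hc hab hbc haX hbX hcX
    have hb : b ∈ Finset.Icc 1 n := by
      rw [Finset.mem_Icc] at ha hc ⊢
      omega
    have la := labelSet_insert ha X
    have lb := labelSet_insert hb X
    have lc := labelSet_insert hc X
    have lab := labelSet_insert ha (insert b X)
    have lac := labelSet_insert ha (insert c X)
    have lbc := labelSet_insert hb (insert c X)
    rw [lb] at lab
    rw [lc] at lac lbc
    rw [Finset.mem_Icc] at ha hb hc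
    set a' : Fin n := ⟨a - 1, by omega⟩ with ha'
    set b' : Fin n := ⟨b - 1, by omega⟩ with hb'
    set c' : Fin n := ⟨c - 1, by omega⟩ with hc'
    set X' := labelSet n X with hX'
    have hab' : a' < b' := by simp only [ha', hb', Fin.lt_def]; omega
    have hbc' : b' < c' := by simp only [hb', hc', Fin.lt_def]; omega
    have haX' : a' ∉ X' := by
      simpa [hX', labelSet, ha', Nat.sub_add_cancel ha.1] using haX
    have hbX' : b' ∉ X' := by
      simpa [hX', labelSet, hb', Nat.sub_add_cancel hb.1] using hbX
    have hcX' : c' ∉ X' := by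
      simpa [hX', labelSet, hc', Nat.sub_add_cancel hc.1] using hcX
    have ka : (insert a' X').card = X'.card + 1 := Finset.card_insert_of_notMem haX'
    have kb : (insert b' X').card = X'.card + 1 := Finset.card_insert_of_notMem hbX'
    have kc : (insert c' X').card = X'.card + 1 := Finset.card_insert_of_notMem hcX'
    have kab : (insert a' (insert b' X')).card = X'.card + 2 := by
      rw [Finset.card_insert_of_notMem (by simp [haX', hab'.ne]), kb]
    have kac : (insert a' (insert c' X')).card = X'.card + 2 := by
      rw [Finset.card_insert_of_notMem (by simp [haX', (hab'.trans hbc').ne]), kc]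
    have kbc : (insert b' (insert c' X')).card = X'.card + 2 := by
      rw [Finset.card_insert_of_notMem (by simp [hbX', hbc'.ne]), kc]
    have hn : X'.card + 2 ≤ n := by
      rw [← kab]
      exact (Finset.card_le_univ _).trans (by simp)
    let g : Fin (X'.card + 2) → Fin n := fun j => ⟨n - (X'.card + 2) + j, by have := j.2; omega⟩
    have hg : ∀ j, (g j : ℕ) = n - (X'.card + 2) + j := fun j => rfl
    have hg' : ∀ j : Fin (X'.card + 1), ((g ∘ (0 : Fin (X'.card + 2)).succAbove) j : ℕ) =
        n - (X'.card + 1) + j := by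
      intro j
      simp only [Function.comp_apply, hg, Fin.succAbove_zero, Fin.val_succ]
      omega
    -- Deleting column 0 from the last |X| + 2 columns leaves the last |X| + 1, so the smaller
    -- minors are right flag minors as well.
    have key := det_three_term (M.submatrix id g) 0 hab' hbc' haX' ka kb kc kab kac kbc
    rw [rightFlagMinor_eq_of_labelSet_eq M la ka _ hg',
      rightFlagMinor_eq_of_labelSet_eq M lb kb _ hg',
      rightFlagMinor_eq_of_labelSet_eq M lc kc _ hg',
      rightFlagMinor_eq_of_labelSet_eq M lab kab _ hg,
      rightFlagMinor_eq_of_labelSet_eq M lac kac _ hg,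
      rightFlagMinor_eq_of_labelSet_eq M lbc kbc _ hg]
    exact key

/-! ### Minors with consecutive rows or columns as flag minors. -/

theorem det_submatrix_append {α R : Type*} [CommRing R] {k l : ℕ} (A : Matrix α α R)
    (f₁ g₁ : Fin k → α) (f₂ g₂ : Fin l → α) (h : ∀ i j, A (f₂ i) (g₁ j) = 0) :
    (A.submatrix (Fin.append f₁ f₂) (Fin.append g₁ g₂)).det =
      (A.submatrix f₁ g₁).det * (A.submatrix f₂ g₂).det := by
  rw [← Matrix.det_submatrix_equiv_self finSumFinEquiv, Matrix.submatrix_submatrix,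
    ← Matrix.det_fromBlocks_zero₂₁ _ (A.submatrix f₁ g₂)]
  congr 1
  ext (i | i) (j | j) <;> simp [h]

theorem IsUpperUnitriangular.det_submatrix_self {n k : ℕ} {A : Matrix (Fin n) (Fin n) ℝ}
    (hA : IsUpperUnitriangular A) {g : Fin k → Fin n} (hg : StrictMono g) :
    (A.submatrix g g).det = 1 := by
  rw [Matrix.det_of_isUpperTriangular]
  · exact Finset.prod_eq_one fun i _ => hA.2 (g i)
  · intro i j hij
    exact hA.1 _ _ (hg hij)

theorem strictMono_fin_append {α : Type*} [Preorder α] {k l : ℕ} {f : Fin k → α} {g : Fin l → α}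
    (hf : StrictMono f) (hg : StrictMono g) (h : ∀ i j, f i < g j) :
    StrictMono (Fin.append f g) := by
  intro i j
  refine Fin.addCases (fun i => ?_) (fun i => ?_) i <;>
    refine Fin.addCases (fun j => ?_) (fun j => ?_) j <;> intro hij <;>
    have hij := Fin.lt_def.1 hij <;>
    simp only [Fin.val_natAdd, Fin.val_castAdd] at hij <;>
    simp only [Fin.append_left, Fin.append_right]
  · exact hf (Fin.lt_def.2 hij)
  · exact h i j
  · omega
  · exact hg (Fin.lt_def.2 (by omega))

/-- A minor with consecutive columns is a right flag minor. -/
theorem IsUpperUnitriangular.rightFlagMinor_eq_det {n k : ℕ} {A : Matrix (Fin n) (Fin n) ℝ}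
    (hA : IsUpperUnitriangular A) {I J : Fin k → Fin n} (hI : StrictMono I) {s : ℕ}
    (hs : s + k ≤ n) (hlt : ∀ i, (I i : ℕ) < s + k) (hJ : ∀ i, (J i : ℕ) = s + i) {L : Finset ℕ}
    (hL : ∀ x : Fin n, (x : ℕ) + 1 ∈ L ↔ (∃ i, I i = x) ∨ s + k ≤ x) :
    rightFlagMinor A L = (A.submatrix I J).det := by
  let g : Fin (n - (s + k)) → Fin n := fun t => ⟨s + k + t, by have := t.2; omega⟩
  have hg : StrictMono g := fun i j hij => by
    have : (i : ℕ) < j := hij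
    simp only [g, Fin.lt_def]; omega
  -- Adjoining all rows and columns from s + k on gives a block triangular matrix with a
  -- unitriangular corner, so the determinant is unchanged.
  rw [rightFlagMinor_eq A (Fin.append I g) (Fin.append J g), det_submatrix_append,
    hA.det_submatrix_self hg, mul_one]
  · intro i j
    refine hA.1 _ _ ?_
    have := hJ j
    have := j.2
    simp only [g, Fin.lt_def]; omega
  · refine strictMono_fin_append hI hg fun i j => ?_
    have := hlt i
    simp only [g, Fin.lt_def]
    omega
  · intro x
    rw [hL]
    constructor
    · rintro (⟨i, rfl⟩ | h)
      · exact ⟨Fin.castAdd _ i, by simp⟩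
      · refine ⟨Fin.natAdd _ ⟨x - (s + k), by have := x.2; omega⟩, ?_⟩
        simp only [Fin.append_right, g, Fin.ext_iff]
        omega
    · rintro ⟨i, rfl⟩
      refine Fin.addCases (fun i => ?_) (fun i => ?_) i
      · exact Or.inl ⟨i, by simp⟩
      · right
        simp [g]
  · intro j
    refine Fin.addCases (fun j => ?_) (fun j => ?_) j
    · simp only [Fin.append_left, Fin.val_castAdd, hJ]; omega
    · simp only [Fin.append_right, Fin.val_natAdd, g]; omega

/-- A minor with consecutive rows is an upper flag minor. -/
theorem IsUpperUnitriangular.upperFlagMinor_eq_det {n k : ℕ} {A : Matrix (Fin n) (Fin n) ℝ}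
    (hA : IsUpperUnitriangular A) {I J : Fin k → Fin n} (hJ : StrictMono J) {s : ℕ}
    (hs : s ≤ n) (hle : ∀ i, s ≤ (J i : ℕ)) (hI : ∀ i, (I i : ℕ) = s + i) {L : Finset ℕ}
    (hL : ∀ x : Fin n, (x : ℕ) + 1 ∈ L ↔ (x : ℕ) < s ∨ ∃ i, J i = x) :
    upperFlagMinor A L = (A.submatrix I J).det := by
  let g : Fin s → Fin n := Fin.castLE hs
  have hg : StrictMono g := Fin.strictMono_castLE hs
  rw [upperFlagMinor_eq A (Fin.append g J) (Fin.append g I), det_submatrix_append,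
    hA.det_submatrix_self hg, one_mul]
  · intro i j
    refine hA.1 _ _ ?_
    have := hI i
    have := j.2
    simp only [g, Fin.lt_def, Fin.val_castLE]; omega
  · refine strictMono_fin_append hg hJ fun i j => ?_
    have := hle j
    simp only [g, Fin.lt_def, Fin.val_castLE]
    omega
  · intro x
    rw [hL]
    constructor
    · rintro (h | ⟨i, rfl⟩)
      · exact ⟨Fin.castAdd _ ⟨x, h⟩, by rw [Fin.append_left]; rfl⟩
      · exact ⟨Fin.natAdd _ i, by simp⟩
    · rintro ⟨i, rfl⟩
      refine Fin.addCases (fun i => ?_) (fun i => ?_) i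
      · left
        simp [g]
      · exact Or.inr ⟨i, by simp⟩
  · intro j
    refine Fin.addCases (fun j => ?_) (fun j => ?_) j
    · simp [g]
    · simp only [Fin.append_right, Fin.val_natAdd, hI]

/-! ### Total positivity from positivity of the right flag minors. -/

theorem Finset.card_filter_lt_orderEmbOfFin {α : Type*} [LinearOrder α] {S : Finset α} {m : ℕ}
    (hS : S.card = m) (i : Fin m) :
    (S.filter fun x => x < S.orderEmbOfFin hS i).card = i := by
  have : (S.filter fun x => x < S.orderEmbOfFin hS i) =
      (Finset.Iio i).map (S.orderEmbOfFin hS).toEmbedding := by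
    ext x
    simp only [Finset.mem_filter, Finset.mem_map, Finset.mem_Iio, RelEmbedding.coe_toEmbedding]
    constructor
    · rintro ⟨hx, hlt⟩
      have hx' : x ∈ Set.range (S.orderEmbOfFin hS) := by
        rw [Finset.range_orderEmbOfFin]; exact hx
      obtain ⟨j, rfl⟩ := hx'
      exact ⟨j, (S.orderEmbOfFin hS).lt_iff_lt.1 hlt, rfl⟩
    · rintro ⟨j, hj, rfl⟩
      exact ⟨Finset.orderEmbOfFin_mem S hS j, (S.orderEmbOfFin hS).lt_iff_lt.2 hj⟩
  rw [this, Finset.card_map, Fin.card_Iio]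

/-- Replacing an element by a larger one moves the sorted sequence up. -/
theorem Finset.orderEmbOfFin_insert_le {α : Type*} [LinearOrder α] {X : Finset α} {a b : α}
    {m : ℕ} (hab : a < b) (haX : a ∉ X) (ha : (insert a X).card = m)
    (hb : (insert b X).card = m) (i : Fin m) :
    (insert a X).orderEmbOfFin ha i ≤ (insert b X).orderEmbOfFin hb i := by
  by_contra! hlt
  have h1 := Finset.card_filter_lt_orderEmbOfFin ha i
  have h2 := Finset.card_filter_lt_orderEmbOfFin hb i
  set y := (insert a X).orderEmbOfFin ha i
  set z := (insert b X).orderEmbOfFin hb i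
  have hz : z ∈ insert b X := Finset.orderEmbOfFin_mem _ _ _
  have h3 : i + 1 ≤ ((insert b X).filter fun x => x < y).card := by
    rw [← h2, ← Finset.card_insert_of_notMem (a := z) (by simp)]
    refine Finset.card_le_card fun x hx => ?_
    rw [Finset.mem_insert, Finset.mem_filter] at hx
    rw [Finset.mem_filter]
    rcases hx with rfl | hx
    · exact ⟨hz, hlt⟩
    · exact ⟨hx.1, hx.2.trans hlt⟩
  have h4 : ((insert b X).filter fun x => x < y).card ≤
      ((insert a X).filter fun x => x < y).card := by
    rw [Finset.filter_insert, Finset.filter_insert]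
    by_cases hby : b < y
    · rw [if_pos hby, if_pos (hab.trans hby),
        Finset.card_insert_of_notMem (a := a) (by simp [haX])]
      exact Finset.card_insert_le _ _
    · rw [if_neg hby]
      split_ifs
      · exact Finset.card_le_card (Finset.subset_insert _ _)
      · exact le_rfl
  omega

/-- Taking a and c to be the minimum and maximum ensures that replacing either by b strictly reduces
the spread of the set. -/
theorem Finset.exists_eq_insert_insert_of_gap {α : Type*} [LinearOrder α] {S : Finset α}
    {x b y : α} (hx : x ∈ S) (hy : y ∈ S) (hxb : x < b) (hby : b < y) (hb : b ∉ S) :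
    ∃ (a c : α) (X : Finset α), S = insert a (insert c X) ∧ a < b ∧ b < c ∧ b ∉ X ∧
      ∀ z ∈ X, a < z ∧ z < c := by
  have hne : S.Nonempty := ⟨x, hx⟩
  have ha : S.min' hne < b := (Finset.min'_le S x hx).trans_lt hxb
  have hc : b < S.max' hne := hby.trans_le (Finset.le_max' S y hy)
  refine ⟨S.min' hne, S.max' hne, (S.erase (S.max' hne)).erase (S.min' hne), ?_, ha, hc, ?_, ?_⟩
  · rw [Finset.insert_comm, Finset.insert_erase, Finset.insert_erase (Finset.max'_mem _ _)]
    exact Finset.mem_erase.2 ⟨(ha.trans hc).ne, Finset.min'_mem _ _⟩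
  · simp [hb]
  · intro z hz
    simp only [Finset.mem_erase] at hz
    exact ⟨lt_of_le_of_ne (Finset.min'_le _ _ hz.2.2) (Ne.symm hz.1),
      lt_of_le_of_ne (Finset.le_max' _ _ hz.2.2) hz.2.1⟩

theorem Finset.orderEmbOfFin_val_eq_of_no_gap {n k : ℕ} {S : Finset (Fin n)}
    (hS : S.card = k + 1) (h : ∀ x ∈ S, ∀ y ∈ S, ∀ b, x < b → b < y → b ∈ S) (i : Fin (k + 1)) :
    (S.orderEmbOfFin hS i : ℕ) = S.orderEmbOfFin hS 0 + i := by
  induction i using Fin.induction with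
  | zero => simp
  | succ i ih =>
    have hlt : S.orderEmbOfFin hS i.castSucc < S.orderEmbOfFin hS i.succ :=
      (S.orderEmbOfFin hS).strictMono Fin.castSucc_lt_succ
    have hlt' : (S.orderEmbOfFin hS i.castSucc : ℕ) < S.orderEmbOfFin hS i.succ := hlt
    by_contra hne
    rw [Fin.val_castSucc] at ih
    rw [Fin.val_succ] at hne
    let b : Fin n := ⟨S.orderEmbOfFin hS i.castSucc + 1, by
      have := (S.orderEmbOfFin hS i.succ).2; omega⟩
    have h1 : S.orderEmbOfFin hS i.castSucc < b := by simp [b, Fin.lt_def]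
    have h2 : b < S.orderEmbOfFin hS i.succ := by simp only [b, Fin.lt_def]; omega
    have hb := h _ (Finset.orderEmbOfFin_mem S hS _) _ (Finset.orderEmbOfFin_mem S hS _) b h1 h2
    have hb' : b ∈ Set.range (S.orderEmbOfFin hS) := by
      rw [Finset.range_orderEmbOfFin]; exact hb
    obtain ⟨t, ht⟩ := hb'
    rw [← ht, OrderEmbedding.lt_iff_lt] at h1 h2
    have h1' : (i : ℕ) < t := h1
    have h2' : (t : ℕ) < i + 1 := h2
    omega

/-- Induction on the size, then on the spread of the column set. Without gaps the minor is a right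
flag minor. With a gap b between the extremes a and c, the three-term relation expresses its product
with a smaller positive minor as a sum of products of smaller or less spread minors, one product
positive and the other nonnegative. -/
theorem IsUpperUnitriangular.det_submatrix_pos {n : ℕ} {A : Matrix (Fin n) (Fin n) ℝ}
    (hA : IsUpperUnitriangular A) (hpos : ∀ I ⊆ Finset.Icc 1 n, 0 < rightFlagMinor A I) (k : ℕ) :
    ∀ (w : ℕ) (S : Finset (Fin n)) (hS : S.card = k) (I : Fin k → Fin n), StrictMono I →
      (∀ i, I i ≤ S.orderEmbOfFin hS i) → (∀ x ∈ S, ∀ y ∈ S, (y : ℕ) ≤ x + w) →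
      0 < (A.submatrix I (S.orderEmbOfFin hS)).det := by
  induction k with
  | zero => intros; simp
  | succ k ihk =>
    intro w
    induction w using Nat.strong_induction_on with
    | _ w ihw =>
    intro S hS I hI hle hw
    by_cases hgap : ∀ x ∈ S, ∀ y ∈ S, ∀ b, x < b → b < y → b ∈ S
    · have hval := Finset.orderEmbOfFin_val_eq_of_no_gap hS hgap
      have hlast := hval (Fin.last k)
      have hlt := (S.orderEmbOfFin hS (Fin.last k)).2
      rw [Fin.val_last] at hlast
      rw [← hA.rightFlagMinor_eq_det hI (s := S.orderEmbOfFin hS 0)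
        (L := (Finset.Icc 1 n).filter fun x => (∃ i, (I i : ℕ) + 1 = x) ∨
          (S.orderEmbOfFin hS 0 : ℕ) + (k + 1) < x) (by omega) ?_ hval ?_]
      · exact hpos _ (Finset.filter_subset _ _)
      · intro i
        have h1 : (I i : ℕ) ≤ S.orderEmbOfFin hS i := hle i
        have := hval i
        have := i.2
        omega
      · intro x
        simp only [Finset.mem_filter, Finset.mem_Icc, Fin.ext_iff, Nat.add_right_cancel_iff]
        have := x.2
        constructor
        · rintro ⟨-, h | h⟩
          · exact Or.inl h
          · right; omega
        · rintro (h | h)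
          · exact ⟨by omega, Or.inl h⟩
          · exact ⟨by omega, Or.inr (by omega)⟩
    · push Not at hgap
      obtain ⟨x, hx, y, hy, b, hxb, hby, hbS⟩ := hgap
      obtain ⟨a, c, X, rfl, hab, hbc, hbX, hX⟩ :=
        Finset.exists_eq_insert_insert_of_gap hx hy hxb hby hbS
      have haX : a ∉ X := fun h => lt_irrefl _ (hX a h).1
      have hcX : c ∉ X := fun h => lt_irrefl _ (hX c h).2
      have hac := hab.trans hbc
      have kc : (insert c X).card = X.card + 1 := Finset.card_insert_of_notMem hcX
      have kac : (insert a (insert c X)).card = X.card + 2 := by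
        rw [Finset.card_insert_of_notMem (by simp [hac.ne, haX]), kc]
      obtain rfl : k = X.card + 1 := by omega
      have ka : (insert a X).card = X.card + 1 := Finset.card_insert_of_notMem haX
      have kb : (insert b X).card = X.card + 1 := Finset.card_insert_of_notMem hbX
      have kab : (insert a (insert b X)).card = X.card + 2 := by
        rw [Finset.card_insert_of_notMem (by simp [hab.ne, haX]), kb]
      have kbc : (insert b (insert c X)).card = X.card + 2 := by
        rw [Finset.card_insert_of_notMem (by simp [hbc.ne, hbX]), kc]
      set l : Fin (X.card + 2) := Fin.last (X.card + 1) with hl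
      have hI' : StrictMono (I ∘ l.succAbove) := hI.comp (Fin.strictMono_succAbove l)
      -- After transposition the sorted sets index columns, and the last row of I is the one
      -- deleted. Since c is the maximum of S, deleting its last element leaves a and X, so the row
      -- bound is inherited.
      have key := det_three_term (Aᵀ.submatrix id I) l hab hbc haX ka kb kc kab hS kbc
      have tr : ∀ {m : ℕ} (J : Fin m → Fin n) (f : Fin m → Fin (X.card + 2)),
          ((Aᵀ.submatrix id I).submatrix J f).det = (A.submatrix (I ∘ f) J).det := by
        intro m J f
        rw [← Matrix.det_transpose]
        rfl
      simp only [tr, Function.comp_id] at key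
      have hn : ∀ (T : Finset (Fin n)), ∀ x ∈ T, ∀ y ∈ T, (y : ℕ) ≤ x + n := fun T x _ y _ => by
        have := y.2; omega
      -- Replacing a or c by b can destroy the bound of rows by columns; the minor is then zero, so
      -- nonnegativity always survives.
      have nonneg : ∀ {m : ℕ} (T : Finset (Fin n)) (hT : T.card = m) (K : Fin m → Fin n),
          StrictMono K → ((∀ i, K i ≤ T.orderEmbOfFin hT i) →
            0 < (A.submatrix K (T.orderEmbOfFin hT)).det) →
          0 ≤ (A.submatrix K (T.orderEmbOfFin hT)).det := by
        intro m T hT K hK h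
        by_cases hcmp : ∀ i, K i ≤ T.orderEmbOfFin hT i
        · exact (h hcmp).le
        · push Not at hcmp
          obtain ⟨i, hi⟩ := hcmp
          exact (hA.det_submatrix_eq_zero hK.monotone (OrderEmbedding.monotone _) hi).ge
      have ea := Finset.orderEmbOfFin_comp hS ka l.succAbove (Fin.strictMono_succAbove l) (by
        intro i
        have h1 := Finset.orderEmbOfFin_mem _ hS (l.succAbove i)
        have h2 : (insert a (insert c X)).orderEmbOfFin hS (l.succAbove i) <
            (insert a (insert c X)).orderEmbOfFin hS l := by
          rw [OrderEmbedding.lt_iff_lt, hl, Fin.succAbove_last]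
          exact Fin.castSucc_lt_last i
        have h3 : (insert a (insert c X)).orderEmbOfFin hS l ≤ c := by
          have := Finset.orderEmbOfFin_mem _ hS l
          simp only [Finset.mem_insert] at this
          rcases this with h | h | h
          · rw [h]; exact hac.le
          · rw [h]
          · exact (hX _ h).2.le
        have h4 := (h2.trans_le h3).ne
        simp only [Finset.mem_insert] at h1 ⊢
        tauto)
      have la : ∀ i, (I ∘ l.succAbove) i ≤ (insert a X).orderEmbOfFin ka i := by
        intro i
        rw [ea]
        exact hle _
      have pa := ihk n (insert a X) ka _ hI' la (hn _)
      have pb := ihk n (insert b X) kb _ hI'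
        (fun i => (la i).trans (Finset.orderEmbOfFin_insert_le hab haX ka kb i)) (hn _)
      have nc := nonneg (insert c X) kc _ hI' fun h => ihk n (insert c X) kc _ hI' h (hn _)
      have hwac := hw a (by simp) c (by simp)
      have hab' : (a : ℕ) < b := hab
      have hbc' : (b : ℕ) < c := hbc
      have hX' : ∀ z ∈ X, (a : ℕ) < z ∧ (z : ℕ) < c := fun z hz => ⟨(hX z hz).1, (hX z hz).2⟩
      have pbc := ihw (w - 1) (by omega) (insert b (insert c X)) kbc I hI
        (fun i => (hle i).trans
          (Finset.orderEmbOfFin_insert_le hab (by simp [hac.ne, haX]) hS kbc i)) (by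
            have hr : ∀ z ∈ insert b (insert c X), (a : ℕ) < z ∧ (z : ℕ) ≤ c := by
              intro z hz
              simp only [Finset.mem_insert] at hz
              rcases hz with rfl | rfl | hz
              · omega
              · omega
              · have := hX' z hz; omega
            intro x hx y hy
            have := hr x hx
            have := hr y hy
            omega)
      have nab := nonneg (insert a (insert b X)) kab I hI fun h =>
        ihw (w - 1) (by omega) (insert a (insert b X)) kab I hI h (by
            have hr : ∀ z ∈ insert a (insert b X), (a : ℕ) ≤ z ∧ (z : ℕ) < c := by
              intro z hz
              simp only [Finset.mem_insert] at hz
              rcases hz with rfl | rfl | hz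
              · omega
              · omega
              · have := hX' z hz; omega
            intro x hx y hy
            have := hr x hx
            have := hr y hy
            omega)
      have h1 := mul_nonneg nab nc
      have h2 := mul_pos pa pbc
      exact pos_of_mul_pos_right (key ▸ add_pos_of_nonneg_of_pos h1 h2) pb.le

/-- An upper unitriangular matrix with positive right flag minors is totally positive. -/
theorem IsUpperUnitriangular.isTotallyPositive {n : ℕ} {A : Matrix (Fin n) (Fin n) ℝ}
    (hA : IsUpperUnitriangular A) (hpos : ∀ I ⊆ Finset.Icc 1 n, 0 < rightFlagMinor A I) :
    IsTotallyPositiveUnitriangular A := by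
  refine isTotallyPositiveUnitriangular_iff.2 ⟨hA, fun k I J hI hJ hIJ => ?_⟩
  have hS : (Finset.univ.image J).card = k := by
    rw [Finset.card_image_of_injective _ hJ.injective, Finset.card_univ, Fintype.card_fin]
  have hJ' := Finset.orderEmbOfFin_unique hS (f := J)
    (fun i => Finset.mem_image_of_mem _ (Finset.mem_univ _)) hJ
  rw [hJ'] at hIJ ⊢
  exact hA.det_submatrix_pos hpos k n _ hS I hI hIJ fun x _ y _ => by have := y.2; omega

/-! ### Reflection in the antidiagonal. -/

/-- The labels `n + 1 - x`, `x ∈ I`. -/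
def reflectLabels (n : ℕ) (I : Finset ℕ) : Finset ℕ :=
  (Finset.Icc 1 n).filter fun x => n + 1 - x ∈ I

/-- Reflection of a matrix in the antidiagonal. -/
def antitranspose {n : ℕ} (M : Matrix (Fin n) (Fin n) ℝ) : Matrix (Fin n) (Fin n) ℝ :=
  Mᵀ.submatrix Fin.rev Fin.rev

theorem antitranspose_antitranspose {n : ℕ} (M : Matrix (Fin n) (Fin n) ℝ) :
    antitranspose (antitranspose M) = M := by
  ext i j
  simp [antitranspose]

theorem IsUpperUnitriangular.antitranspose {n : ℕ} {M : Matrix (Fin n) (Fin n) ℝ}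
    (hM : IsUpperUnitriangular M) : IsUpperUnitriangular (antitranspose M) :=
  ⟨fun _ _ hij => hM.1 _ _ (Fin.rev_lt_rev.2 hij), fun _ => hM.2 _⟩

theorem strictMono_rev_comp_rev {n m : ℕ} {f : Fin m → Fin n} (hf : StrictMono f) :
    StrictMono (Fin.rev ∘ f ∘ Fin.rev) :=
  fun _ _ hij => Fin.rev_lt_rev.2 (hf (Fin.rev_lt_rev.2 hij))

/-- Rows and columns are both reversed, so the two signs cancel. -/
theorem det_antitranspose_submatrix {n m : ℕ} (M : Matrix (Fin n) (Fin n) ℝ)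
    (f g : Fin m → Fin n) :
    ((antitranspose M).submatrix (Fin.rev ∘ f ∘ Fin.rev) (Fin.rev ∘ g ∘ Fin.rev)).det =
      (M.submatrix g f).det := by
  rw [← Matrix.det_transpose (M.submatrix g f),
    ← Matrix.det_submatrix_equiv_self Fin.revPerm (M.submatrix g f)ᵀ]
  congr 1
  ext i j
  simp [antitranspose]

theorem IsTotallyPositiveUnitriangular.antitranspose {n : ℕ} {M : Matrix (Fin n) (Fin n) ℝ}
    (hM : IsTotallyPositiveUnitriangular M) :
    IsTotallyPositiveUnitriangular (antitranspose M) := by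
  rw [isTotallyPositiveUnitriangular_iff] at hM ⊢
  refine ⟨hM.1.antitranspose, fun k I J hI hJ hIJ => ?_⟩
  have h := det_antitranspose_submatrix M (Fin.rev ∘ I ∘ Fin.rev) (Fin.rev ∘ J ∘ Fin.rev)
  have hr : ∀ f : Fin k → Fin n, Fin.rev ∘ (Fin.rev ∘ f ∘ Fin.rev) ∘ Fin.rev = f := fun f => by
    ext i; simp
  rw [hr, hr] at h
  rw [h]
  exact hM.2 k _ _ (strictMono_rev_comp_rev hJ) (strictMono_rev_comp_rev hI)
    fun i => Fin.rev_le_rev.2 (hIJ _)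

theorem reflectLabels_spec {n m : ℕ} {I : Finset ℕ} {f : Fin m → Fin n}
    (hI : ∀ x : Fin n, (x : ℕ) + 1 ∈ I ↔ ∃ i, f i = x) (x : Fin n) :
    (x : ℕ) + 1 ∈ reflectLabels n I ↔ ∃ i, (Fin.rev ∘ f ∘ Fin.rev) i = x := by
  have h := hI x.rev
  have hx := x.2
  rw [Fin.val_rev, show n - (x + 1) + 1 = n + 1 - (x + 1) by omega] at h
  simp only [reflectLabels, Finset.mem_filter, Finset.mem_Icc, h]
  constructor
  · rintro ⟨-, i, hi⟩
    exact ⟨i.rev, by simp [hi]⟩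
  · rintro ⟨i, rfl⟩
    exact ⟨by omega, i.rev, by simp⟩

theorem labelSet_spec (n : ℕ) (I : Finset ℕ) (x : Fin n) :
    (x : ℕ) + 1 ∈ I ↔ ∃ i, (labelSet n I).orderEmbOfFin rfl i = x := by
  have : x ∈ Set.range ((labelSet n I).orderEmbOfFin rfl) ↔ x ∈ labelSet n I := by
    rw [Finset.range_orderEmbOfFin, Finset.mem_coe]
  rw [← Set.mem_range, this]
  simp [labelSet]

theorem upperFlagMinor_eq_rightFlagMinor_antitranspose {n : ℕ} (M : Matrix (Fin n) (Fin n) ℝ)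
    (J : Finset ℕ) :
    upperFlagMinor M J = rightFlagMinor (antitranspose M) (reflectLabels n J) := by
  have hc := labelSet_card_le n J
  rw [rightFlagMinor_eq (antitranspose M) _
    (Fin.rev ∘ (Fin.castLE (labelSet_card_le n J)) ∘ Fin.rev)
    (strictMono_rev_comp_rev ((labelSet n J).orderEmbOfFin rfl).strictMono)
    (reflectLabels_spec (labelSet_spec n J)), det_antitranspose_submatrix]
  · rfl
  · intro j
    have := j.2
    simp only [Function.comp_apply, Fin.val_rev, Fin.val_castLE]
    omega

/-- Only the rows are reversed, so a sign remains; it depends on I only through the size of its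
label set. -/
theorem rightFlagMinor_submatrix_rev {n : ℕ} (M : Matrix (Fin n) (Fin n) ℝ) (I : Finset ℕ) :
    rightFlagMinor (M.submatrix Fin.rev id) I =
      ((Equiv.Perm.sign (Fin.revPerm : Equiv.Perm (Fin (labelSet n I).card)) : ℤ) : ℝ) *
        rightFlagMinor M (reflectLabels n I) := by
  let g : Fin (labelSet n I).card → Fin n := fun k =>
    ⟨n - (labelSet n I).card + k, by
      have h1 := labelSet_card_le n I
      have h2 := k.isLt
      omega⟩
  rw [rightFlagMinor_eq M _ g
    (strictMono_rev_comp_rev ((labelSet n I).orderEmbOfFin rfl).strictMono)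
    (reflectLabels_spec (labelSet_spec n I)) (fun _ => rfl), ← Matrix.det_permute]
  rw [rightFlagMinor]
  congr 1
  ext i j
  simp [g]

/-! ### Gauss decomposition: flag minors, existence, uniqueness. -/

/-- With L lower triangular, the last m columns of A L involve only the last m columns of A, so
Cauchy–Binet has a single term. -/
theorem det_mul_submatrix_of_lower {n m : ℕ} (A L : Matrix (Fin n) (Fin n) ℝ)
    (hL : ∀ i j, i < j → L i j = 0) (f g : Fin m → Fin n) (hm : m ≤ n)
    (hg : ∀ j, (g j : ℕ) = n - m + j) :
    ((A * L).submatrix f g).det = (A.submatrix f g).det * (L.submatrix g g).det := by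
  rw [← Matrix.det_mul]
  congr 1
  ext i j
  have hinj : Function.Injective g := fun a b hab => by
    have h := congrArg Fin.val hab
    rw [hg, hg] at h
    exact Fin.ext (by omega)
  simp only [Matrix.submatrix_apply, Matrix.mul_apply]
  rw [← Finset.sum_image (s := Finset.univ) (g := g) (f := fun l => A (f i) l * L l (g j))
    hinj.injOn]
  symm
  refine Finset.sum_subset (Finset.subset_univ _) fun l _ hl => ?_
  rw [hL, mul_zero]
  by_contra hlt
  apply hl
  have h1 : (g j : ℕ) ≤ l := not_lt.1 hlt
  have h2 := hg j
  have h3 := l.2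
  refine Finset.mem_image.2 ⟨⟨l - (n - m), by omega⟩, Finset.mem_univ _, Fin.ext ?_⟩
  rw [hg]
  simp only
  omega

theorem antidiagonalMatrix_mul {n : ℕ} (M : Matrix (Fin n) (Fin n) ℝ) :
    antidiagonalMatrix n * M = M.submatrix Fin.rev id := by
  ext i j
  have hi := i.2
  rw [Matrix.mul_apply, Finset.sum_eq_single i.rev]
  · simp only [antidiagonalMatrix, Matrix.of_apply, Fin.val_rev, Matrix.submatrix_apply, id]
    rw [if_pos (by omega), one_mul]
  · intro l _ hl
    simp only [antidiagonalMatrix, Matrix.of_apply]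
    rw [if_neg, zero_mul]
    intro h
    exact hl (Fin.ext (by rw [Fin.val_rev]; omega))
  · simp

theorem antidiagonalMatrix_transpose (n : ℕ) :
    (antidiagonalMatrix n)ᵀ = antidiagonalMatrix n := by
  ext i j
  simp only [antidiagonalMatrix, Matrix.transpose_apply, Matrix.of_apply]
  rw [add_comm (j : ℕ)]

theorem mul_antidiagonalMatrix {n : ℕ} (M : Matrix (Fin n) (Fin n) ℝ) :
    M * antidiagonalMatrix n = M.submatrix id Fin.rev := by
  rw [← Matrix.transpose_inj, Matrix.transpose_mul, antidiagonalMatrix_transpose,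
    antidiagonalMatrix_mul]
  rfl

theorem antidiagonalMatrix_mul_self (n : ℕ) :
    antidiagonalMatrix n * antidiagonalMatrix n = 1 := by
  rw [antidiagonalMatrix_mul]
  ext i j
  have hi := i.2
  simp only [antidiagonalMatrix, Matrix.submatrix_apply, Matrix.of_apply, id, Matrix.one_apply,
    Fin.val_rev, Fin.ext_iff]
  congr 1
  rw [eq_iff_iff]
  omega

theorem antitranspose_eq {n : ℕ} (M : Matrix (Fin n) (Fin n) ℝ) :
    antitranspose M = antidiagonalMatrix n * Mᵀ * antidiagonalMatrix n := by
  rw [antidiagonalMatrix_mul, mul_antidiagonalMatrix]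
  rfl

/-- The flag minors of the left factor of the Gauss decomposition. -/
theorem rightFlagMinor_mul_of_gauss {n : ℕ} {M A B : Matrix (Fin n) (Fin n) ℝ} {d : Fin n → ℝ}
    (hA : IsUpperUnitriangular A) (hB : IsUpperUnitriangular B)
    (h : antidiagonalMatrix n * M * antidiagonalMatrix n =
      A * antidiagonalMatrix n * Matrix.diagonal d * B) (I : Finset ℕ) :
    rightFlagMinor A I * rightFlagMinor M (Finset.Icc 1 (labelSet n I).card) =
      rightFlagMinor M (reflectLabels n I) := by
  set L := antidiagonalMatrix n * (Matrix.diagonal d * B) * antidiagonalMatrix n with hL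
  have hX : M.submatrix Fin.rev id = A * L := by
    rw [← antidiagonalMatrix_mul, hL, ← Matrix.mul_one (antidiagonalMatrix n * M),
      ← antidiagonalMatrix_mul_self, ← Matrix.mul_assoc, h]
    simp only [Matrix.mul_assoc]
  have hlow : ∀ i j, i < j → L i j = 0 := by
    intro i j hij
    rw [hL, antidiagonalMatrix_mul, mul_antidiagonalMatrix]
    simp only [Matrix.submatrix_apply, id, Matrix.diagonal_mul]
    rw [hB.1 _ _ (Fin.rev_lt_rev.2 hij), mul_zero]
  set m := (labelSet n I).card with hm
  have hmn : m ≤ n := labelSet_card_le n I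
  let g : Fin m → Fin n := fun k => ⟨n - m + k, by have h2 := k.isLt; omega⟩
  have hg : StrictMono g := fun i j hij => by
    have : (i : ℕ) < j := hij
    simp only [g, Fin.lt_def]; omega
  -- On the last m rows the flag minor of A is 1, so this row set computes the minor of L common to
  -- all I of size m.
  have hI₀ : ∀ x : Fin n, (x : ℕ) + 1 ∈ Finset.Icc (n - m + 1) n ↔ ∃ i, g i = x := by
    intro x
    rw [Finset.mem_Icc]
    constructor
    · intro hx
      exact ⟨⟨x - (n - m), by omega⟩, Fin.ext (by simp only [g]; omega)⟩
    · rintro ⟨i, rfl⟩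
      have := i.2
      simp only [g]
      omega
  have hcard : (labelSet n (Finset.Icc (n - m + 1) n)).card = m := by
    have : labelSet n (Finset.Icc (n - m + 1) n) = Finset.univ.image g := by
      ext x
      simp only [labelSet, Finset.mem_filter, Finset.mem_univ, true_and, Finset.mem_image, hI₀]
    rw [this, Finset.card_image_of_injective _ hg.injective, Finset.card_univ, Fintype.card_fin]
  have hrefl : reflectLabels n (Finset.Icc (n - m + 1) n) = Finset.Icc 1 m := by
    ext x
    simp only [reflectLabels, Finset.mem_filter, Finset.mem_Icc]
    omega
  have e1 := rightFlagMinor_submatrix_rev M I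
  have e2 := rightFlagMinor_submatrix_rev M (Finset.Icc (n - m + 1) n)
  rw [hrefl, hcard] at e2
  rw [← hm] at e1
  have e3 : rightFlagMinor (A * L) I = rightFlagMinor A I * (L.submatrix g g).det :=
    det_mul_submatrix_of_lower A L hlow _ g hmn fun _ => rfl
  have e4 : rightFlagMinor (A * L) (Finset.Icc (n - m + 1) n) = (L.submatrix g g).det := by
    rw [rightFlagMinor_eq (A * L) g g hg hI₀ fun _ => rfl,
      det_mul_submatrix_of_lower A L hlow g g hmn fun _ => rfl, hA.det_submatrix_self hg, one_mul]
  rw [hX] at e1 e2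
  rw [e3] at e1
  rw [e4] at e2
  set ε := ((Equiv.Perm.sign (Fin.revPerm : Equiv.Perm (Fin m)) : ℤ) : ℝ) with hε
  have hεε : ε * ε = 1 := by
    rw [hε, ← Int.cast_mul, Int.units_coe_mul_self, Int.cast_one]
  rw [e2] at e1
  linear_combination ε * e1 - (rightFlagMinor A I * rightFlagMinor M (Finset.Icc 1 m) -
    rightFlagMinor M (reflectLabels n I)) * hεε

theorem isTotallyPositive_of_gauss {n : ℕ} {M A B : Matrix (Fin n) (Fin n) ℝ} {d : Fin n → ℝ}
    (hM : IsTotallyPositiveUnitriangular M) (hA : IsUpperUnitriangular A)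
    (hB : IsUpperUnitriangular B) (h : antidiagonalMatrix n * M * antidiagonalMatrix n =
      A * antidiagonalMatrix n * Matrix.diagonal d * B) : IsTotallyPositiveUnitriangular A := by
  refine hA.isTotallyPositive fun I _ => ?_
  have := rightFlagMinor_mul_of_gauss hA hB h I
  exact pos_of_mul_pos_left (this ▸ hM.rightFlagMinor_pos _) (hM.rightFlagMinor_pos _).le

/-- Transpose and conjugate by P: the outer factors change places while the diagonal stays put.
Statements about the left factor thus transfer to the right one. -/
theorem gauss_antitranspose {n : ℕ} {M A B : Matrix (Fin n) (Fin n) ℝ} {d : Fin n → ℝ}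
    (h : antidiagonalMatrix n * M * antidiagonalMatrix n =
      A * antidiagonalMatrix n * Matrix.diagonal d * B) :
    antidiagonalMatrix n * antitranspose M * antidiagonalMatrix n =
      antitranspose B * antidiagonalMatrix n * Matrix.diagonal d * antitranspose A := by
  have hP := antidiagonalMatrix_mul_self n
  have hPl : ∀ X : Matrix (Fin n) (Fin n) ℝ,
      antidiagonalMatrix n * (antidiagonalMatrix n * X) = X := fun X => by
    rw [← Matrix.mul_assoc, hP, Matrix.one_mul]
  have ht := congrArg Matrix.transpose h
  simp only [Matrix.transpose_mul, antidiagonalMatrix_transpose, Matrix.diagonal_transpose,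
    Matrix.mul_assoc] at ht
  simp only [antitranspose_eq, Matrix.mul_assoc, hP, hPl, Matrix.mul_one]
  have := congrArg (fun X => antidiagonalMatrix n * X * antidiagonalMatrix n) ht
  simpa only [Matrix.mul_assoc, hP, hPl, Matrix.mul_one] using this

theorem IsUpperUnitriangular.eq_of_rightFlagMinor_eq {n : ℕ} {A B : Matrix (Fin n) (Fin n) ℝ}
    (hA : IsUpperUnitriangular A) (hB : IsUpperUnitriangular B)
    (h : ∀ I, rightFlagMinor A I = rightFlagMinor B I) : A = B := by
  ext i j
  rcases lt_or_ge j i with hij | hij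
  · rw [hA.1 _ _ hij, hB.1 _ _ hij]
  -- Every entry on or above the diagonal is a 1 × 1 minor, hence a right flag minor.
  · have key : ∀ {C : Matrix (Fin n) (Fin n) ℝ}, IsUpperUnitriangular C →
        rightFlagMinor C (insert ((i : ℕ) + 1) (Finset.Icc ((j : ℕ) + 2) n)) = C i j := by
      intro C hC
      have hij' : (i : ℕ) ≤ j := hij
      have hj := j.2
      rw [hC.rightFlagMinor_eq_det (k := 1) (I := fun _ => i) (J := fun _ => j) (s := j)
        (Subsingleton.strictMono _) (by omega) (fun _ => by omega) (fun t => by simp)]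
      · simp
      · intro x
        have := x.2
        simp only [Finset.mem_insert, Finset.mem_Icc, Fin.ext_iff, exists_const]
        omega
    rw [← key hA, ← key hB, h]

theorem eq_of_gauss {n : ℕ} {M A B A' B' : Matrix (Fin n) (Fin n) ℝ} {d d' : Fin n → ℝ}
    (hM : IsTotallyPositiveUnitriangular M) (hA : IsUpperUnitriangular A)
    (hB : IsUpperUnitriangular B) (hA' : IsUpperUnitriangular A') (hB' : IsUpperUnitriangular B')
    (h : antidiagonalMatrix n * M * antidiagonalMatrix n =
      A * antidiagonalMatrix n * Matrix.diagonal d * B)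
    (h' : antidiagonalMatrix n * M * antidiagonalMatrix n =
      A' * antidiagonalMatrix n * Matrix.diagonal d' * B') : A = A' := by
  refine hA.eq_of_rightFlagMinor_eq hA' fun I => ?_
  have e := rightFlagMinor_mul_of_gauss hA hB h I
  have e' := rightFlagMinor_mul_of_gauss hA' hB' h' I
  exact mul_right_cancel₀ (hM.rightFlagMinor_pos _).ne' (e.trans e'.symm)

theorem IsUpperUnitriangular.det_eq_one {n : ℕ} {A : Matrix (Fin n) (Fin n) ℝ}
    (hA : IsUpperUnitriangular A) : A.det = 1 := by
  simpa using hA.det_submatrix_self (g := id) strictMono_id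

theorem diagonal_eq_of_gauss {n : ℕ} {A B : Matrix (Fin n) (Fin n) ℝ} {d d' : Fin n → ℝ}
    (hA : IsUpperUnitriangular A) (hB : IsUpperUnitriangular B)
    (h : A * antidiagonalMatrix n * Matrix.diagonal d * B =
      A * antidiagonalMatrix n * Matrix.diagonal d' * B) : d = d' := by
  have uA : IsUnit A := by rw [Matrix.isUnit_iff_isUnit_det, hA.det_eq_one]; exact isUnit_one
  have uB : IsUnit B := by rw [Matrix.isUnit_iff_isUnit_det, hB.det_eq_one]; exact isUnit_one
  have uP : IsUnit (antidiagonalMatrix n) :=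
    IsUnit.of_mul_eq_one _ (antidiagonalMatrix_mul_self n)
  exact Matrix.diagonal_injective ((uA.mul uP).mul_left_cancel (uB.mul_right_cancel h))

/-- Up to sign, this trailing principal minor of the reversed matrix is a right flag minor of M,
hence nonzero. -/
theorem det_submatrix_Ici_ne_zero {n : ℕ} {M : Matrix (Fin n) (Fin n) ℝ}
    (hM : IsTotallyPositiveUnitriangular M) (j : Fin n) :
    ((M.submatrix Fin.rev id).submatrix ((↑) : {i // j ≤ i} → Fin n) (↑)).det ≠ 0 := by
  let e : Fin (n - j) ≃ {i : Fin n // j ≤ i} :=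
    { toFun := fun t => ⟨⟨j + t, by have := t.2; omega⟩, by simp [Fin.le_def]⟩
      invFun := fun i => ⟨(i : Fin n) - j, by
        have h1 := i.1.2
        have h2 : (j : ℕ) ≤ i.1 := i.2
        omega⟩
      left_inv := fun t => by simp
      right_inv := fun i => by
        have h2 : (j : ℕ) ≤ i.1 := i.2
        exact Subtype.ext (Fin.ext (by simp only; omega)) }
  rw [← Matrix.det_submatrix_equiv_self e, Matrix.submatrix_submatrix,
    ← rightFlagMinor_eq (I := Finset.Icc ((j : ℕ) + 1) n), rightFlagMinor_submatrix_rev]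
  · exact mul_ne_zero (Int.cast_ne_zero.2 (Units.ne_zero _)) (hM.rightFlagMinor_pos _).ne'
  · intro s t hst
    have : (s : ℕ) < t := hst
    simp only [e, Function.comp_apply, Equiv.coe_fn_mk, Fin.lt_def]
    omega
  · intro x
    have hx := x.2
    rw [Finset.mem_Icc]
    constructor
    · intro h
      have hjx : j ≤ x := Fin.le_def.2 (by omega)
      exact ⟨e.symm ⟨x, hjx⟩, by simp⟩
    · rintro ⟨i, rfl⟩
      have : (j : ℕ) ≤ (e i).1 := (e i).2
      simp only [Function.comp_apply]
      omega
  · intro t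
    have := j.2
    simp only [e, Function.comp_apply, Equiv.coe_fn_mk]
    omega

/-- The reversed matrix is the product of an upper unitriangular and an invertible lower triangular
matrix. -/
theorem exists_upper_mul_lower {n : ℕ} {M : Matrix (Fin n) (Fin n) ℝ}
    (hM : IsTotallyPositiveUnitriangular M) :
    ∃ A L : Matrix (Fin n) (Fin n) ℝ, IsUpperUnitriangular A ∧ L.IsLowerTriangular ∧
      L.det ≠ 0 ∧ M.submatrix Fin.rev id = A * L := by
  set X := M.submatrix Fin.rev id with hX
  let C : ∀ j : Fin n, Matrix {i // j ≤ i} {i // j ≤ i} ℝ := fun j => X.submatrix (↑) (↑)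
  -- Column j of the lower triangular K solves the trailing system with right-hand side the first
  -- unit vector; this forces X K to be upper unitriangular.
  let κ : ∀ j : Fin n, {i // j ≤ i} → ℝ := fun j => (C j)⁻¹ *ᵥ Pi.single ⟨j, le_rfl⟩ 1
  have hκ : ∀ j, C j *ᵥ κ j = Pi.single ⟨j, le_rfl⟩ 1 := by
    intro j
    have hu : IsUnit (C j).det := (det_submatrix_Ici_ne_zero hM j).isUnit
    simp only [κ, Matrix.mulVec_mulVec, Matrix.mul_nonsing_inv _ hu, Matrix.one_mulVec]
  let K : Matrix (Fin n) (Fin n) ℝ := Matrix.of fun l j =>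
    if h : j ≤ l then κ j ⟨l, h⟩ else 0
  have hK : K.IsLowerTriangular := by
    intro i j hij
    have hij : i < j := hij
    simp [K, hij.not_ge]
  have hXK : ∀ i j (h : j ≤ i), (X * K) i j =
      (Pi.single ⟨j, le_rfl⟩ 1 : {i // j ≤ i} → ℝ) ⟨i, h⟩ := by
    intro i j h
    rw [← hκ j, Matrix.mul_apply]
    rw [← Finset.sum_subset (Finset.subset_univ (Finset.univ.filter fun l => j ≤ l)),
      Finset.sum_subtype (p := fun l => j ≤ l) _ (by simp)]
    · refine Finset.sum_congr rfl fun l _ => ?_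
      simp [K, C, l.2]
    · intro l _ hl
      have hl' : ¬ j ≤ l := by simpa using hl
      simp [K, hl']
  have hA : IsUpperUnitriangular (X * K) := by
    refine ⟨fun i j hij => ?_, fun i => ?_⟩
    · rw [hXK i j hij.le, Pi.single_eq_of_ne]
      intro h
      exact hij.ne' (congrArg Subtype.val h)
    · rw [hXK i i le_rfl, Pi.single_eq_same]
  have hdet : X.det * K.det = 1 := by rw [← Matrix.det_mul, hA.det_eq_one]
  have hKu : IsUnit K.det := IsUnit.of_mul_eq_one X.det (by rw [mul_comm]; exact hdet)
  let := Matrix.invertibleOfIsUnitDet K hKu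
  refine ⟨X * K, K⁻¹, hA, Matrix.blockTriangular_inv_of_blockTriangular hK, ?_, ?_⟩
  · exact ((Matrix.isUnit_nonsing_inv_det_iff).2 hKu).ne_zero
  · rw [Matrix.mul_assoc, Matrix.mul_nonsing_inv _ hKu, Matrix.mul_one]

theorem exists_gauss {n : ℕ} {M : Matrix (Fin n) (Fin n) ℝ}
    (hM : IsTotallyPositiveUnitriangular M) :
    ∃ (A B : Matrix (Fin n) (Fin n) ℝ) (d : Fin n → ℝ), IsUpperUnitriangular A ∧
      IsUpperUnitriangular B ∧ antidiagonalMatrix n * M * antidiagonalMatrix n =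
        A * antidiagonalMatrix n * Matrix.diagonal d * B := by
  obtain ⟨A, L, hA, hL, hdet, hX⟩ := exists_upper_mul_lower hM
  have hd : ∀ i, L i i ≠ 0 := by
    rw [Matrix.det_of_isLowerTriangular _ hL] at hdet
    exact fun i => Finset.prod_ne_zero_iff.1 hdet i (Finset.mem_univ i)
  -- P L P is upper triangular; its diagonal gives d, and dividing its rows by that diagonal gives
  -- B.
  refine ⟨A, Matrix.of fun i j => (L i.rev i.rev)⁻¹ * L i.rev j.rev, fun i => L i.rev i.rev, hA,
    ⟨fun i j hij => ?_, fun i => ?_⟩, ?_⟩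
  · have h0 : L i.rev j.rev = 0 := hL (Fin.rev_lt_rev.2 hij)
    simp [h0]
  · simp [hd i.rev]
  · have hU : Matrix.diagonal (fun i : Fin n => L i.rev i.rev) *
        (Matrix.of fun i j : Fin n => (L i.rev i.rev)⁻¹ * L i.rev j.rev) =
        antidiagonalMatrix n * (L * antidiagonalMatrix n) := by
      rw [antidiagonalMatrix_mul, mul_antidiagonalMatrix]
      ext i j
      rw [Matrix.diagonal_mul]
      simp [hd i.rev]
    rw [Matrix.mul_assoc (A * antidiagonalMatrix n), hU, Matrix.mul_assoc A,
      ← Matrix.mul_assoc (antidiagonalMatrix n) (antidiagonalMatrix n),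
      antidiagonalMatrix_mul_self, Matrix.one_mul, antidiagonalMatrix_mul, hX, Matrix.mul_assoc]

theorem exists_isGaussTriple {n : ℕ} {M : Matrix (Fin n) (Fin n) ℝ}
    (hM : IsTotallyPositiveUnitriangular M) :
    ∃ (A B : Matrix (Fin n) (Fin n) ℝ) (d : Fin n → ℝ), IsGaussTriple M A B d := by
  obtain ⟨A, B, d, hA, hB, h⟩ := exists_gauss hM
  refine ⟨A, B, d, isTotallyPositive_of_gauss hM hA hB h, ?_, h⟩
  rw [← antitranspose_antitranspose B]
  exact (isTotallyPositive_of_gauss hM.antitranspose hB.antitranspose hA.antitranspose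
    (gauss_antitranspose h)).antitranspose

theorem IsGaussTriple.unique {n : ℕ} {M A B A' B' : Matrix (Fin n) (Fin n) ℝ} {d d' : Fin n → ℝ}
    (hM : IsTotallyPositiveUnitriangular M) (h : IsGaussTriple M A B d)
    (h' : IsGaussTriple M A' B' d') : A = A' ∧ B = B' ∧ d = d' := by
  obtain ⟨⟨hA, -⟩, ⟨hB, -⟩, e⟩ := h
  obtain ⟨⟨hA', -⟩, ⟨hB', -⟩, e'⟩ := h'
  obtain rfl := eq_of_gauss hM hA hB hA' hB' e e'
  have hBB := eq_of_gauss hM.antitranspose hB.antitranspose hA.antitranspose hB'.antitranspose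
    hA.antitranspose (gauss_antitranspose e) (gauss_antitranspose e')
  obtain rfl : B = B' := by
    rw [← antitranspose_antitranspose B, hBB, antitranspose_antitranspose]
  exact ⟨rfl, rfl, diagonal_eq_of_gauss hA hB (e.symm.trans e')⟩

theorem IsGaussTriple.antitranspose {n : ℕ} {M A B : Matrix (Fin n) (Fin n) ℝ} {d : Fin n → ℝ}
    (h : IsGaussTriple M A B d) :
    IsGaussTriple (antitranspose M) (antitranspose B) (antitranspose A) d :=
  ⟨h.2.1.antitranspose, h.1.antitranspose, gauss_antitranspose h.2.2⟩

/-! ### The ratios `Y` under reflection, Gauss decomposition and shear. -/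

theorem lowerY_eq_exchangeRatio {n : ℕ} (M : Matrix (Fin n) (Fin n) ℝ) {a b c : ℕ} (ha : 1 ≤ a)
    (hab : a < b) (hbc : b < c) (hc : c ≤ n) :
    lowerY M a b c = exchangeRatio (rightFlagMinor M) (exchangeContext n 0 a b c) a b c := by
  unfold lowerY exchangeRatio
  congr 2 <;> congr 1 <;> ext x <;>
    simp only [exchangeContext, Finset.mem_insert, Finset.mem_filter, Finset.mem_union,
      Finset.mem_Icc] <;> omega

theorem lowerYTilde_eq_exchangeRatio {n : ℕ} (M : Matrix (Fin n) (Fin n) ℝ) {a b c : ℕ}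
    (ha : 1 ≤ a) (hab : a < b) (hbc : b < c) (hc : c ≤ n) :
    lowerYTilde M a b c = exchangeRatio (rightFlagMinor M) (exchangeContext n n a b c) a b c := by
  unfold lowerYTilde exchangeRatio
  congr 2 <;> congr 1 <;> ext x <;>
    simp only [exchangeContext, Finset.mem_insert, Finset.mem_filter, Finset.mem_union,
      Finset.mem_Icc] <;> omega

theorem upperY_eq_exchangeRatio {n : ℕ} (M : Matrix (Fin n) (Fin n) ℝ) {a b c : ℕ} (ha : 1 ≤ a)
    (hab : a < b) (hbc : b < c) (hc : c ≤ n) :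
    upperY M a b c = (exchangeRatio (upperFlagMinor M) (exchangeContext n 0 a b c) a b c)⁻¹ := by
  unfold upperY exchangeRatio
  rw [inv_div]
  congr 2 <;> congr 1 <;> ext x <;>
    simp only [exchangeContext, Finset.mem_insert, Finset.mem_filter, Finset.mem_union,
      Finset.mem_Icc] <;> omega

theorem upperYTilde_eq_exchangeRatio {n : ℕ} (M : Matrix (Fin n) (Fin n) ℝ) {a b c : ℕ}
    (ha : 1 ≤ a) (hab : a < b) (hbc : b < c) (hc : c ≤ n) :
    upperYTilde M a b c =
      (exchangeRatio (upperFlagMinor M) (exchangeContext n n a b c) a b c)⁻¹ := by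
  unfold upperYTilde exchangeRatio
  rw [inv_div]
  congr 2 <;> congr 1 <;> ext x <;>
    simp only [exchangeContext, Finset.mem_insert, Finset.mem_filter, Finset.mem_union,
      Finset.mem_Icc] <;> omega

theorem reflectLabels_insert {n a : ℕ} (ha : a ∈ Finset.Icc 1 n) (X : Finset ℕ) :
    reflectLabels n (insert a X) = insert (n + 1 - a) (reflectLabels n X) := by
  rw [Finset.mem_Icc] at ha
  ext x
  simp only [reflectLabels, Finset.mem_insert, Finset.mem_filter, Finset.mem_Icc, and_or_left]
  refine or_congr_left ?_
  omega

/-- Reflection reverses a < b < c, and interchanging the outer labels swaps numerator and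
denominator. -/
theorem exchangeRatio_reflectLabels {n : ℕ} (f : Finset ℕ → ℝ) (X : Finset ℕ) {a b c : ℕ}
    (ha : a ∈ Finset.Icc 1 n) (hb : b ∈ Finset.Icc 1 n) (hc : c ∈ Finset.Icc 1 n) :
    exchangeRatio (fun I => f (reflectLabels n I)) X a b c =
      (exchangeRatio f (reflectLabels n X) (n + 1 - c) (n + 1 - b) (n + 1 - a))⁻¹ := by
  unfold exchangeRatio
  simp only [reflectLabels_insert ha, reflectLabels_insert hb, reflectLabels_insert hc]
  rw [inv_div, Finset.insert_comm (n + 1 - c), Finset.insert_comm (n + 1 - b) (n + 1 - a)]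
  congr 1 <;> exact mul_comm _ _

theorem reflectLabels_exchangeContext_zero {n a b c : ℕ} (hab : a < b)
    (hbc : b < c) (hc : c ≤ n) :
    reflectLabels n (exchangeContext n 0 a b c) =
      exchangeContext n n (n + 1 - c) (n + 1 - b) (n + 1 - a) := by
  ext x
  simp only [reflectLabels, exchangeContext, Finset.mem_filter, Finset.mem_Icc]
  omega

theorem reflectLabels_exchangeContext_self {n a b c : ℕ} (hab : a < b)
    (hbc : b < c) (hc : c ≤ n) :
    reflectLabels n (exchangeContext n n a b c) =
      exchangeContext n 0 (n + 1 - c) (n + 1 - b) (n + 1 - a) := by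
  ext x
  simp only [reflectLabels, exchangeContext, Finset.mem_filter, Finset.mem_Icc]
  omega

theorem upperY_eq_lowerYTilde_antitranspose {n : ℕ} (M : Matrix (Fin n) (Fin n) ℝ) {a b c : ℕ}
    (ha : 1 ≤ a) (hab : a < b) (hbc : b < c) (hc : c ≤ n) :
    upperY M a b c = lowerYTilde (antitranspose M) (n + 1 - c) (n + 1 - b) (n + 1 - a) := by
  rw [upperY_eq_exchangeRatio M ha hab hbc hc,
    lowerYTilde_eq_exchangeRatio _ (by omega) (by omega) (by omega) (by omega),
    ← reflectLabels_exchangeContext_zero hab hbc hc,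
    funext (upperFlagMinor_eq_rightFlagMinor_antitranspose M),
    exchangeRatio_reflectLabels _ _ (Finset.mem_Icc.2 (by omega)) (Finset.mem_Icc.2 (by omega))
      (Finset.mem_Icc.2 (by omega)), inv_inv]

theorem upperYTilde_eq_lowerY_antitranspose {n : ℕ} (M : Matrix (Fin n) (Fin n) ℝ) {a b c : ℕ}
    (ha : 1 ≤ a) (hab : a < b) (hbc : b < c) (hc : c ≤ n) :
    upperYTilde M a b c = lowerY (antitranspose M) (n + 1 - c) (n + 1 - b) (n + 1 - a) := by
  rw [upperYTilde_eq_exchangeRatio M ha hab hbc hc,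
    lowerY_eq_exchangeRatio _ (by omega) (by omega) (by omega) (by omega),
    ← reflectLabels_exchangeContext_self hab hbc hc,
    funext (upperFlagMinor_eq_rightFlagMinor_antitranspose M),
    exchangeRatio_reflectLabels _ _ (Finset.mem_Icc.2 (by omega)) (Finset.mem_Icc.2 (by omega))
      (Finset.mem_Icc.2 (by omega)), inv_inv]

theorem card_labelSet_insert {n a : ℕ} (ha : a ∈ Finset.Icc 1 n) {X : Finset ℕ} (haX : a ∉ X) :
    (labelSet n (insert a X)).card = (labelSet n X).card + 1 := by
  rw [labelSet_insert ha, Finset.card_insert_of_notMem]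
  rw [Finset.mem_Icc] at ha
  simpa [labelSet, Nat.sub_add_cancel ha.1] using haX

/-- Numerator and denominator each contain one set of size |X| + 1 and one of size |X| + 2 (counted
in labels), so the size-dependent factors of `rightFlagMinor_mul_of_gauss` cancel. -/
theorem IsGaussTriple.exchangeRatio_eq {n : ℕ} {M A B : Matrix (Fin n) (Fin n) ℝ}
    {d : Fin n → ℝ} (hM : IsTotallyPositiveUnitriangular M) (h : IsGaussTriple M A B d)
    {X : Finset ℕ} {a b c : ℕ} (ha : a ∈ Finset.Icc 1 n) (hb : b ∈ Finset.Icc 1 n)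
    (hc : c ∈ Finset.Icc 1 n) (hab : a < b) (hbc : b < c) (haX : a ∉ X) (hbX : b ∉ X)
    (hcX : c ∉ X) :
    exchangeRatio (rightFlagMinor A) X a b c =
      (exchangeRatio (rightFlagMinor M) (reflectLabels n X)
        (n + 1 - c) (n + 1 - b) (n + 1 - a))⁻¹ := by
  rw [← exchangeRatio_reflectLabels _ _ ha hb hc]
  unfold exchangeRatio
  have key := rightFlagMinor_mul_of_gauss h.1.1 h.2.1.1 h.2.2
  have pos := fun I => (hM.rightFlagMinor_pos I).ne'
  have posA := fun I => (h.1.rightFlagMinor_pos I).ne'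
  have hbcX : b ∉ insert c X := by simp [hbX, hbc.ne]
  have habX : a ∉ insert b X := by simp [haX, hab.ne]
  simp only [← key, card_labelSet_insert hb hbcX, card_labelSet_insert ha habX,
    card_labelSet_insert ha haX, card_labelSet_insert hb hbX, card_labelSet_insert hc hcX]
  have p1 := pos (Finset.Icc 1 ((labelSet n X).card + 1))
  have p2 := pos (Finset.Icc 1 ((labelSet n X).card + 1 + 1))
  have p3 := posA (insert a (insert b X))
  have p4 := posA (insert c X)
  field_simp

theorem IsGaussTriple.lowerY_eq {n : ℕ} {M A B : Matrix (Fin n) (Fin n) ℝ}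
    {d : Fin n → ℝ} (hM : IsTotallyPositiveUnitriangular M) (h : IsGaussTriple M A B d)
    {a b c : ℕ} (ha : 1 ≤ a) (hab : a < b) (hbc : b < c) (hc : c ≤ n) :
    lowerY A a b c = 1 / lowerYTilde M (n + 1 - c) (n + 1 - b) (n + 1 - a) := by
  rw [lowerY_eq_exchangeRatio _ ha hab hbc hc,
    lowerYTilde_eq_exchangeRatio _ (by omega) (by omega) (by omega) (by omega), one_div,
    ← reflectLabels_exchangeContext_zero hab hbc hc]
  refine h.exchangeRatio_eq hM ?_ ?_ ?_ hab hbc ?_ ?_ ?_ <;>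
    simp only [exchangeContext, Finset.mem_Icc, Finset.mem_filter] <;> omega

theorem IsGaussTriple.lowerYTilde_eq {n : ℕ} {M A B : Matrix (Fin n) (Fin n) ℝ}
    {d : Fin n → ℝ} (hM : IsTotallyPositiveUnitriangular M) (h : IsGaussTriple M A B d)
    {a b c : ℕ} (ha : 1 ≤ a) (hab : a < b) (hbc : b < c) (hc : c ≤ n) :
    lowerYTilde A a b c = 1 / lowerY M (n + 1 - c) (n + 1 - b) (n + 1 - a) := by
  rw [lowerYTilde_eq_exchangeRatio _ ha hab hbc hc,
    lowerY_eq_exchangeRatio _ (by omega) (by omega) (by omega) (by omega), one_div,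
    ← reflectLabels_exchangeContext_self hab hbc hc]
  refine h.exchangeRatio_eq hM ?_ ?_ ?_ hab hbc ?_ ?_ ?_ <;>
    simp only [exchangeContext, Finset.mem_Icc, Finset.mem_filter] <;> omega

/-- A minor with consecutive rows and consecutive columns is both a right and an upper flag
minor. -/
theorem IsUpperUnitriangular.rightFlagMinor_eq_upperFlagMinor {n : ℕ}
    {M : Matrix (Fin n) (Fin n) ℝ} (hM : IsUpperUnitriangular M) {a k c : ℕ} (ha : 1 ≤ a)
    (hac : a + k ≤ c + 1) (hc : c ≤ n) {L L' : Finset ℕ}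
    (hL : ∀ x, x ∈ L ↔ (a ≤ x ∧ x < a + k) ∨ (c < x ∧ x ≤ n))
    (hL' : ∀ x, x ∈ L' ↔ (1 ≤ x ∧ x < a) ∨ (c < x + k ∧ x ≤ c)) :
    rightFlagMinor M L = upperFlagMinor M L' := by
  let I : Fin k → Fin n := fun i => ⟨a - 1 + i, by have := i.2; omega⟩
  let J : Fin k → Fin n := fun i => ⟨c - k + i, by have := i.2; omega⟩
  have hI : StrictMono I := fun i j hij => by
    have : (i : ℕ) < j := hij
    simp only [I, Fin.lt_def]; omega
  have hJ : StrictMono J := fun i j hij => by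
    have : (i : ℕ) < j := hij
    simp only [J, Fin.lt_def]; omega
  rw [hM.rightFlagMinor_eq_det (I := I) (J := J) hI (s := c - k) (by omega) ?_ (fun _ => rfl),
    hM.upperFlagMinor_eq_det (I := I) (J := J) hJ (s := a - 1) (by omega) ?_ (fun _ => rfl)]
  · intro x
    have hx := x.2
    rw [hL']
    constructor
    · rintro (h | h)
      · left; omega
      · exact Or.inr ⟨⟨x - (c - k), by omega⟩, Fin.ext (by simp only [J]; omega)⟩
    · rintro (h | ⟨i, rfl⟩)
      · left; omega
      · have := i.2
        simp only [J]; omega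
  · intro i
    simp only [J]; omega
  · intro x
    have hx := x.2
    rw [hL]
    constructor
    · rintro (h | h)
      · exact Or.inl ⟨⟨x - (a - 1), by omega⟩, Fin.ext (by simp only [I]; omega)⟩
      · right; omega
    · rintro (⟨i, rfl⟩ | h)
      · have := i.2
        simp only [I]; omega
      · right; omega
  · intro i
    have := i.2
    simp only [I]; omega

/-- All four minors have consecutive rows and columns. Trading the row interval for the column
interval of the same length replaces b by a + c - b. -/
theorem IsUpperUnitriangular.lowerY_eq_upperYTilde {n : ℕ} {M : Matrix (Fin n) (Fin n) ℝ}
    (hM : IsUpperUnitriangular M) {a b c : ℕ} (ha : 1 ≤ a) (hab : a < b) (hbc : b < c)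
    (hc : c ≤ n) : lowerY M a b c = upperYTilde M a (a + c - b) c := by
  unfold lowerY upperYTilde
  rw [mul_comm (upperFlagMinor M _) (upperFlagMinor M (Finset.Icc 1 (a - 1) ∪
      Finset.Icc (a + c - b + 1) c)),
    mul_comm (upperFlagMinor M (Finset.Icc 1 a ∪ Finset.Icc (a + c - b + 1) (c - 1)))]
  congr 2
  · refine hM.rightFlagMinor_eq_upperFlagMinor (a := a) (k := b - a) (c := c) (by omega) (by omega)
      (by omega) ?_ ?_ <;> intro x <;> simp only [Finset.mem_union, Finset.mem_Icc] <;> omega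
  · refine hM.rightFlagMinor_eq_upperFlagMinor (a := a + 1) (k := b - a) (c := c - 1) (by omega)
      (by omega) (by omega) ?_ ?_ <;> intro x <;> simp only [Finset.mem_union, Finset.mem_Icc] <;>
      omega
  · refine hM.rightFlagMinor_eq_upperFlagMinor (a := a) (k := b - a + 1) (c := c) (by omega)
      (by omega) (by omega) ?_ ?_ <;> intro x <;> simp only [Finset.mem_union, Finset.mem_Icc] <;>
      omega
  · refine hM.rightFlagMinor_eq_upperFlagMinor (a := a + 1) (k := b - a - 1) (c := c - 1)
      (by omega) (by omega) (by omega) ?_ ?_ <;> intro x <;>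
      simp only [Finset.mem_union, Finset.mem_Icc] <;> omega

/-! ### Sums over the tetrahedron and the conclusion. -/

theorem dilogSum_congr {n : ℕ} {Y Z : ℕ → ℕ → ℕ → ℝ}
    (h : ∀ a b c, 1 ≤ a → a < b → b < c → c ≤ n → Y a b c = Z a b c) :
    dilogSum n Y = dilogSum n Z := by
  refine Finset.sum_congr rfl fun t ht => ?_
  simp only [tetrahedron, Finset.mem_filter, Finset.mem_product, Finset.mem_Icc] at ht
  rw [h _ _ _ (by omega) ht.2.1 ht.2.2 (by omega)]

theorem dilogSum_reflect (n : ℕ) (Y : ℕ → ℕ → ℕ → ℝ) :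
    dilogSum n (fun a b c => Y (n + 1 - c) (n + 1 - b) (n + 1 - a)) = dilogSum n Y := by
  refine Finset.sum_nbij' (fun t => (n + 1 - t.2.2, n + 1 - t.2.1, n + 1 - t.1))
    (fun t => (n + 1 - t.2.2, n + 1 - t.2.1, n + 1 - t.1)) ?_ ?_ ?_ ?_ ?_
  · simp only [tetrahedron, Finset.mem_filter, Finset.mem_product, Finset.mem_Icc]; omega
  · simp only [tetrahedron, Finset.mem_filter, Finset.mem_product, Finset.mem_Icc]; omega
  · rintro ⟨a, b, c⟩
    simp only [tetrahedron, Finset.mem_filter, Finset.mem_product, Finset.mem_Icc, Prod.mk.injEq]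
    omega
  · rintro ⟨a, b, c⟩
    simp only [tetrahedron, Finset.mem_filter, Finset.mem_product, Finset.mem_Icc, Prod.mk.injEq]
    omega
  · intros; rfl

theorem dilogSum_shear (n : ℕ) (Y : ℕ → ℕ → ℕ → ℝ) :
    dilogSum n (fun a b c => Y a (a + c - b) c) = dilogSum n Y := by
  refine Finset.sum_nbij' (fun t => (t.1, t.1 + t.2.2 - t.2.1, t.2.2))
    (fun t => (t.1, t.1 + t.2.2 - t.2.1, t.2.2)) ?_ ?_ ?_ ?_ ?_
  · simp only [tetrahedron, Finset.mem_filter, Finset.mem_product, Finset.mem_Icc]; omega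
  · simp only [tetrahedron, Finset.mem_filter, Finset.mem_product, Finset.mem_Icc]; omega
  · rintro ⟨a, b, c⟩
    simp only [tetrahedron, Finset.mem_filter, Finset.mem_product, Finset.mem_Icc, Prod.mk.injEq,
      true_and, and_true]
    omega
  · rintro ⟨a, b, c⟩
    simp only [tetrahedron, Finset.mem_filter, Finset.mem_product, Finset.mem_Icc, Prod.mk.injEq,
      true_and, and_true]
    omega
  · intros; rfl

theorem IsTotallyPositiveUnitriangular.dilogSum_lowerY {n : ℕ} {M : Matrix (Fin n) (Fin n) ℝ}
    (hM : IsTotallyPositiveUnitriangular M) :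
    dilogSum n (fun a b c => lowerY M a b c) = dilogSum n (fun a b c => lowerYTilde M a b c) := by
  rw [dilogSum_congr fun a b c h1 h2 h3 h4 => lowerY_eq_exchangeRatio M h1 h2 h3 h4,
    hM.isPositiveFlag.sum_exchangeRatio_eq]
  exact (dilogSum_congr fun a b c h1 h2 h3 h4 => lowerYTilde_eq_exchangeRatio M h1 h2 h3 h4).symm

/-- The function φ will be the identity for the factors and the reciprocal for M. -/
theorem IsUpperUnitriangular.dilogSum_comp_lowerY {n : ℕ} {M : Matrix (Fin n) (Fin n) ℝ}
    (hM : IsUpperUnitriangular M) (φ : ℝ → ℝ) :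
    dilogSum n (fun a b c => φ (lowerY M a b c)) =
      dilogSum n (fun a b c => φ (upperYTilde M a b c)) := by
  rw [← dilogSum_shear n fun a b c => φ (upperYTilde M a b c)]
  exact dilogSum_congr fun a b c h1 h2 h3 h4 => by rw [hM.lowerY_eq_upperYTilde h1 h2 h3 h4]

theorem dilogSum_comp_upperY {n : ℕ} (M : Matrix (Fin n) (Fin n) ℝ) (φ : ℝ → ℝ) :
    dilogSum n (fun a b c => φ (upperY M a b c)) =
      dilogSum n (fun a b c => φ (lowerYTilde (antitranspose M) a b c)) := by
  rw [← dilogSum_reflect n fun a b c => φ (lowerYTilde (antitranspose M) a b c)]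
  exact dilogSum_congr fun a b c h1 h2 h3 h4 => by
    rw [upperY_eq_lowerYTilde_antitranspose M h1 h2 h3 h4]

theorem dilogSum_comp_upperYTilde {n : ℕ} (M : Matrix (Fin n) (Fin n) ℝ) (φ : ℝ → ℝ) :
    dilogSum n (fun a b c => φ (upperYTilde M a b c)) =
      dilogSum n (fun a b c => φ (lowerY (antitranspose M) a b c)) := by
  rw [← dilogSum_reflect n fun a b c => φ (lowerY (antitranspose M) a b c)]
  exact dilogSum_congr fun a b c h1 h2 h3 h4 => by
    rw [upperYTilde_eq_lowerY_antitranspose M h1 h2 h3 h4]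

theorem IsGaussTriple.dilogSum_lowerY {n : ℕ} {M A B : Matrix (Fin n) (Fin n) ℝ}
    {d : Fin n → ℝ} (hM : IsTotallyPositiveUnitriangular M) (h : IsGaussTriple M A B d) :
    dilogSum n (fun a b c => lowerY A a b c) =
      dilogSum n (fun a b c => 1 / lowerYTilde M a b c) := by
  rw [← dilogSum_reflect n fun a b c => 1 / lowerYTilde M a b c]
  exact dilogSum_congr fun a b c h1 h2 h3 h4 => h.lowerY_eq hM h1 h2 h3 h4

theorem IsGaussTriple.dilogSum_lowerYTilde {n : ℕ} {M A B : Matrix (Fin n) (Fin n) ℝ}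
    {d : Fin n → ℝ} (hM : IsTotallyPositiveUnitriangular M) (h : IsGaussTriple M A B d) :
    dilogSum n (fun a b c => lowerYTilde A a b c) =
      dilogSum n (fun a b c => 1 / lowerY M a b c) := by
  rw [← dilogSum_reflect n fun a b c => 1 / lowerY M a b c]
  exact dilogSum_congr fun a b c h1 h2 h3 h4 => h.lowerYTilde_eq hM h1 h2 h3 h4

theorem theorem3p1 (n : ℕ) (M : Matrix (Fin n) (Fin n) ℝ)
    (hM : IsTotallyPositiveUnitriangular M) :
    ∃ (M' M'' : Matrix (Fin n) (Fin n) ℝ) (d : Fin n → ℝ),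
      IsGaussTriple M M' M'' d ∧
      (∀ (A B : Matrix (Fin n) (Fin n) ℝ) (e : Fin n → ℝ),
        IsGaussTriple M A B e → A = M' ∧ B = M'' ∧ e = d) ∧
      dilogSum n (fun a b c => lowerY M' a b c) =
        dilogSum n (fun a b c => 1 / lowerY M a b c) ∧
      dilogSum n (fun a b c => 1 / lowerY M a b c) =
        dilogSum n (fun a b c => lowerY M'' a b c) ∧
      dilogSum n (fun a b c => lowerY M'' a b c) =
        dilogSum n (fun a b c => upperYTilde M' a b c) ∧
      dilogSum n (fun a b c => upperYTilde M' a b c) =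
        dilogSum n (fun a b c => 1 / upperYTilde M a b c) ∧
      dilogSum n (fun a b c => 1 / upperYTilde M a b c) =
        dilogSum n (fun a b c => upperYTilde M'' a b c) ∧
      dilogSum n (fun a b c => upperYTilde M'' a b c) =
        dilogSum n (fun a b c => lowerYTilde M' a b c) ∧
      dilogSum n (fun a b c => lowerYTilde M' a b c) =
        dilogSum n (fun a b c => 1 / lowerYTilde M a b c) ∧
      dilogSum n (fun a b c => 1 / lowerYTilde M a b c) =
        dilogSum n (fun a b c => lowerYTilde M'' a b c) ∧
      dilogSum n (fun a b c => lowerYTilde M'' a b c) =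
        dilogSum n (fun a b c => upperY M' a b c) ∧
      dilogSum n (fun a b c => upperY M' a b c) =
        dilogSum n (fun a b c => 1 / upperY M a b c) ∧
      dilogSum n (fun a b c => 1 / upperY M a b c) =
        dilogSum n (fun a b c => upperY M'' a b c) := by
  obtain ⟨A, B, d, h⟩ := exists_isGaussTriple hM
  have hA := h.1
  have hB := h.2.1
  have hMt := hM.antitranspose
  have ht := h.antitranspose
  have a1 := hA.dilogSum_lowerY
  have a2 := h.dilogSum_lowerY hM
  have a3 := h.dilogSum_lowerYTilde hM
  have a4 := hA.1.dilogSum_comp_lowerY id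
  have a5 := dilogSum_comp_upperY A id
  have a6 := dilogSum_comp_upperYTilde A id
  have a7 := hA.antitranspose.dilogSum_lowerY
  -- The relations for M' and those for M'' (through the reflected triple) are linked only here: m1
  -- and m3 identify the sums of reciprocals for M and its reflection.
  have m1 := hM.1.dilogSum_comp_lowerY (1 / ·)
  have m2 := dilogSum_comp_upperY M (1 / ·)
  have m3 := dilogSum_comp_upperYTilde M (1 / ·)
  have b1 := ht.1.dilogSum_lowerY
  have b2 := ht.dilogSum_lowerY hMt
  have b3 := ht.dilogSum_lowerYTilde hMt
  have b4 := hB.1.dilogSum_comp_lowerY id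
  have b5 := dilogSum_comp_upperY B id
  have b6 := dilogSum_comp_upperYTilde B id
  have b7 := hB.dilogSum_lowerY
  simp only [id] at a4 a5 a6 b4 b5 b6
  refine ⟨A, B, d, h, fun A' B' e h' => h'.unique hM h, ?_⟩
  refine ⟨?_, ?_, ?_, ?_, ?_, ?_, ?_, ?_, ?_, ?_, ?_⟩ <;> linarith
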